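/- Let $k\ge 1$, and for $1\le i\le k$ let $n_i,m_i\ge 1$ be integers. Let $\mathbb F_{n}^+$ denote the free monoid on $n$ generators $g_1,\dots,g_n$, with word length $|\cdot|$ and empty word $g_0$. For each $i$ let $f_i=\sum_{\alpha\in\mathbb F_{n_i}^+}a_{i,\alpha}Z_{i,\alpha}$ be a positive regular free holomorphic function: $a_{i,\alpha}\ge 0$, $a_{i,g_0}=0$, $a_{i,g_j}>0$ for all $j$, and $\limsup_{p\to\infty}\big(\sum_{|\alpha|=p}|a_{i,\alpha}|^2\big)^{1/2p}<\infty$. Let $\mathcal Q$ be a set of polynomials in indeterminates $Z_{i,j}$ ($1\le i\le k$, $1\le j\le n_i$) that are noncommuting for fixed $i$, while $Z_{s,j}$ and $Z_{t,l}$ commute for $s\ne t$. *The variety.* Let $\mathcal H$ be a complex Hilbert space and $\mathbf T=(T_{i,j})$ a tuple of bounded operators on $\mathcal H$. Put $\Phi_{f_i,T_i}(X)=\sum_\alpha a_{i,\alpha}T_{i,\alpha}XT_{i,\alpha}^*$ (weak operator topology), where $T_{i,\alpha}=T_{i,j_1}\cdots T_{i,j_p}$ for $\alpha=g_{j_1}\cdots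 g_{j_p}$, and $\mathbf\Delta^{\mathbf p}_{\mathbf f,\mathbf T}=(\mathrm{id}-\Phi_{f_1,T_1})^{p_1}\circ\cdots\circ(\mathrm{id}-\Phi_{f_k,T_k})^{p_k}$. The tuple $\mathbf T$ belongs to $\mathcal V_{\mathcal Q}(\mathcal H)$ if $T_{s,j}T_{t,l}=T_{t,l}T_{s,j}$ for $s\neq t$, each series $\sum_\alpha a_{i,\alpha}T_{i,\alpha}T_{i,\alpha}^*$ converges in the weak operator topology, $\mathbf\Delta^{\mathbf p}_{\mathbf f,\mathbf T}(I)\ge 0$ for all $\mathbf 0\le\mathbf p\le\mathbf m$, and $q(\mathbf T)=0$ for all $q\in\mathcal Q$. It is pure if $\Phi_{f_i,T_i}^s(I)\to0$ weakly as $s\to\infty$ for each $i$. *The universal model.* Let $F^2_{n}$ be the full Fock space with orthonormal basis $\{e_\alpha\}_{\alpha\in\mathbb F_{n}^+}$. Put $b_{i,g_0}=1$, and for $|\alpha|\ge1$ $$b_{i,\alpha}=\sum_{p=1}^{|\alpha|}\ \sum_{\gamma_1\cdots\gamma_p=\alpha,\ |\gamma_r|\ge1}a_{i,\gamma_1}\cdots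 a_{i,\gamma_p}\binom{p+m_i-1}{m_i-1}.$$ Let $W_{i,j}e_\alpha=\sqrt{b_{i,\alpha}/b_{i,g_j\alpha}}\;e_{g_j\alpha}$ on $F^2_{n_i}$, and let $\mathbf W_{i,j}=I\otimes\cdots\otimes W_{i,j}\otimes\cdots\otimes I$ on $F^2_{n_1}\otimes\cdots\otimes F^2_{n_k}$ ($W_{i,j}$ in the $i$-th place). For $(\alpha)=(\alpha_1,\dots,\alpha_k)$ write $\mathbf W_{(\alpha)}=\mathbf W_{1,\alpha_1}\cdots\mathbf W_{k,\alpha_k}$. Let $\mathcal M_{\mathcal Q}$ be the closed span of the vectors $\mathbf W_{(\alpha)}q(\mathbf W)\mathbf W_{(\beta)}(e_{g_0}\otimes\cdots\otimes e_{g_0})$ with $(\alpha),(\beta)\in\mathbb F_{n_1}^+\times\cdots\times\mathbb F_{n_k}^+$ and $q\in\mathcal Q$. Let $\mathcal N_{\mathcal Q}=\mathcal M_{\mathcal Q}^\perp$ and $\mathbf S_{i,j}=P_{\mathcal N_{\mathcal Q}}\mathbf W_{i,j}|_{\mathcal N_{\mathcal Q}}$. For a Hilbert space $\mathcal E$, say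 that $\mathbf T$ *has a model over* $\mathcal E$ if there are a closed subspace $\mathcal G\subseteq\mathcal N_{\mathcal Q}\otimes\mathcal E$, invariant under each $\mathbf S_{i,j}^*\otimes I_{\mathcal E}$, and a unitary operator $U:\mathcal H\to\mathcal G$ such that $$T_{i,j}^*=U^*\big[(\mathbf S_{i,j}^*\otimes I_{\mathcal E})|_{\mathcal G}\big]U\qquad\text{for all } i,j.$$ **Theorem.** The following are equivalent for a tuple $\mathbf T=(T_{i,j})$ of bounded operators on $\mathcal H$: 1. $\mathbf T\in\mathcal V_{\mathcal Q}(\mathcal H)$ and $\mathbf T$ is pure; 2. each series $\sum_\alpha a_{i,\alpha}T_{i,\alpha}T_{i,\alpha}^*$ converges weakly, $\mathbf\Delta^{\mathbf m}_{\mathbf f,\mathbf T}(I)\ge0$ (so that $\mathbf\Delta^{\mathbf m}_{\mathbf f,\mathbf T}(I)^{1/2}$ is defined), and $\mathbf T$ has a model over $\mathcal D:=\overline{\mathbf\Delta^{\mathbf m}_{\mathbf f,\mathbf T}(I)^{1/2}(\mathcal H)}$. Moreover, if $\mathbf T$ has a model over some Hilbert space $\mathcal E$, then (1) holds, with no assumption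 of convergence or positivity. -/

import Mathlib

open Filter Topology
open scoped ENNReal TensorProduct InnerProduct

noncomputable section

namespace NCPolydomain

/-- A positive regular free holomorphic function `f = ∑_α a_α Z_α` in `n` noncommuting
indeterminates, given by its coefficients `a_α`, `α` in the free monoid on `n` generators. -/
structure PosRegFreeHol (n : ℕ) where
  coeff : FreeMonoid (Fin n) → ℝ
  coeff_nonneg : ∀ α, 0 ≤ coeff α
  coeff_one : coeff 1 = 0
  coeff_of_pos : ∀ j, 0 < coeff (FreeMonoid.of j)
  limsup_lt_top :
    limsup (fun p : ℕ => ENNReal.ofReal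
      ((∑ w : Fin p → Fin n, |coeff (FreeMonoid.ofList (List.ofFn w))| ^ 2) ^
        (1 / (2 * (p : ℝ))))) atTop < ⊤

/-! ### The coefficients `b_α^{(m)}` -/

/-- `b_α^{(m)} = ∑_p ∑_{γ₁ ⋯ γ_p = α, |γ_i| ≥ 1} a_{γ₁} ⋯ a_{γ_p} * C(p + m - 1, m - 1)`.
A factorization of `α` into `p` nonempty words is a composition of `|α|` with `p` blocks.
For the empty word, the only composition has no blocks and the value is `1`. -/
def bCoeff {n : ℕ} (f : PosRegFreeHol n) (m : ℕ) (α : FreeMonoid (Fin n)) : ℝ :=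
  ∑ c : Composition α.toList.length,
    ((α.toList.splitWrtComposition c).map fun γ => f.coeff (FreeMonoid.ofList γ)).prod *
      ((c.length + m - 1).choose (m - 1) : ℝ)

theorem prod_coeff_nonneg {n : ℕ} (f : PosRegFreeHol n) (L : List (List (Fin n))) :
    0 ≤ (L.map fun γ => f.coeff (FreeMonoid.ofList γ)).prod := by
  apply List.prod_nonneg
  intro x hx
  obtain ⟨γ, -, rfl⟩ := List.mem_map.1 hx
  exact f.coeff_nonneg _

theorem bCoeff_nonneg {n : ℕ} (f : PosRegFreeHol n) (m : ℕ) (α : FreeMonoid (Fin n)) :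
    0 ≤ bCoeff f m α :=
  Finset.sum_nonneg fun _ _ => mul_nonneg (prod_coeff_nonneg f _) (Nat.cast_nonneg _)

theorem bCoeff_one {n : ℕ} (f : PosRegFreeHol n) (m : ℕ) : bCoeff f m 1 = 1 := by
  have h0 : bCoeff f m 1 = ∑ c : Composition 0,
      (((([] : List (Fin n)).splitWrtComposition c).map
        fun γ => f.coeff (FreeMonoid.ofList γ)).prod *
        ((c.length + m - 1).choose (m - 1) : ℝ)) := rfl
  have hb : ∀ c : Composition 0, c.blocks = [] := by
    intro c
    have h := c.blocks_sum
    rcases hb : c.blocks with _ | ⟨a, l⟩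
    · rfl
    · have := c.blocks_pos (i := a) (by simp [hb])
      simp [hb] at h
      omega
  have hlen : ∀ c : Composition 0, c.length = 0 := fun c => by
    rw [Composition.length, hb c]; rfl
  rw [h0, Fintype.sum_eq_single (default : Composition 0)]
  · rw [hlen, List.splitWrtComposition, hb]
    simp [List.splitWrtCompositionAux]
  · intro c hc
    exact absurd (Composition.ext ((hb c).trans (hb default).symm)) hc

theorem coeff_mul_bCoeff_le {n : ℕ} (f : PosRegFreeHol n) (m : ℕ) (j : Fin n)
    (α : FreeMonoid (Fin n)) :
    f.coeff (FreeMonoid.of j) * bCoeff f m α ≤ bCoeff f m (FreeMonoid.of j * α) := by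
  have key : ∀ l : List (Fin n),
      f.coeff (FreeMonoid.of j) * bCoeff f m (FreeMonoid.ofList l) ≤
        bCoeff f m (FreeMonoid.ofList (j :: l)) := by
    intro l
    have hb : ∀ l : List (Fin n), bCoeff f m (FreeMonoid.ofList l) =
        ∑ c : Composition l.length,
          ((l.splitWrtComposition c).map fun γ => f.coeff (FreeMonoid.ofList γ)).prod *
            ((c.length + m - 1).choose (m - 1) : ℝ) := fun _ => rfl
    rw [hb, hb]
    let ι : Composition l.length → Composition (j :: l).length := fun c =>
      ⟨1 :: c.blocks, by
        intro i hi
        rcases List.mem_cons.1 hi with rfl | hi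
        · exact Nat.one_pos
        · exact c.blocks_pos hi, by
        simp [c.blocks_sum, add_comm]⟩
    have hι : Function.Injective ι := by
      intro c d h
      have := congrArg Composition.blocks h
      simp only [ι, List.cons.injEq, true_and] at this
      exact Composition.ext this
    rw [Finset.mul_sum]
    refine le_trans (Finset.sum_le_sum (g := fun c =>
      (((j :: l).splitWrtComposition (ι c)).map fun γ => f.coeff (FreeMonoid.ofList γ)).prod *
        (((ι c).length + m - 1).choose (m - 1) : ℝ)) ?_) ?_
    · intro c _
      have h1 : (j :: l).splitWrtComposition (ι c) = [j] :: l.splitWrtComposition c := by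
        simp [List.splitWrtComposition, ι, List.splitWrtCompositionAux]
      have h2 : (ι c).length = c.length + 1 := by simp [ι, Composition.length]
      rw [h1, h2, List.map_cons, List.prod_cons, FreeMonoid.ofList_singleton, ← mul_assoc]
      refine mul_le_mul_of_nonneg_left ?_
        (mul_nonneg (f.coeff_nonneg _) (prod_coeff_nonneg f _))
      exact_mod_cast Nat.choose_le_choose _ (by omega)
    · refine (Finset.sum_map Finset.univ ⟨ι, hι⟩ (fun c =>
        (((j :: l).splitWrtComposition c).map fun γ => f.coeff (FreeMonoid.ofList γ)).prod *
          ((c.length + m - 1).choose (m - 1) : ℝ))).symm.trans_le ?_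
      exact Finset.sum_le_sum_of_subset_of_nonneg (Finset.subset_univ _) fun _ _ _ =>
        mul_nonneg (prod_coeff_nonneg f _) (Nat.cast_nonneg _)
  exact key α.toList

/-- The weight `√b_α / √b_{g_j α}` of the creation operator. -/
def creationWeight {n : ℕ} (f : PosRegFreeHol n) (m : ℕ) (j : Fin n) (α : FreeMonoid (Fin n)) :
    ℝ :=
  √(bCoeff f m α) / √(bCoeff f m (FreeMonoid.of j * α))

theorem abs_creationWeight_le {n : ℕ} (f : PosRegFreeHol n) (m : ℕ) (j : Fin n)
    (α : FreeMonoid (Fin n)) :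
    |creationWeight f m j α| ≤ 1 / √(f.coeff (FreeMonoid.of j)) := by
  have h0 : 0 < √(f.coeff (FreeMonoid.of j)) := Real.sqrt_pos.2 (f.coeff_of_pos j)
  rw [creationWeight, abs_of_nonneg (by positivity)]
  rcases (Real.sqrt_nonneg (bCoeff f m (FreeMonoid.of j * α))).eq_or_lt with h | h
  · rw [← h, div_zero]; positivity
  · rw [div_le_div_iff₀ h h0, one_mul, mul_comm, ← Real.sqrt_mul (f.coeff_nonneg _)]
    exact Real.sqrt_le_sqrt (coeff_mul_bCoeff_le f m j α)

/-! ### Weighted shifts on `ℓ²` -/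

theorem backShift_bound {Ω : Type*} (σ : Ω → Ω) (hσ : σ.Injective) (w : Ω → ℝ) (C : ℝ)
    (hw : ∀ α, |w α| ≤ C) (x : lp (fun _ : Ω => ℂ) 2) :
    Summable (fun α => ‖(w α : ℂ) * x (σ α)‖ ^ 2) ∧
      ∑' α, ‖(w α : ℂ) * x (σ α)‖ ^ 2 ≤ C ^ 2 * ‖x‖ ^ 2 := by
  have hx : Summable fun α => ‖x α‖ ^ 2 := by
    simpa using (lp.memℓp x).summable (by norm_num)
  have hn : ‖x‖ ^ 2 = ∑' α, ‖x α‖ ^ 2 := by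
    simpa using lp.norm_rpow_eq_tsum (p := 2) (by norm_num) x
  have hle : ∀ α, ‖(w α : ℂ) * x (σ α)‖ ^ 2 ≤ C ^ 2 * ‖x (σ α)‖ ^ 2 := by
    intro α
    rw [norm_mul, mul_pow, Complex.norm_real, Real.norm_eq_abs]
    have := hw α
    gcongr
  have hs : Summable fun α => C ^ 2 * ‖x (σ α)‖ ^ 2 := (hx.comp_injective hσ).mul_left _
  have hs' := Summable.of_nonneg_of_le (fun α => by positivity) hle hs
  refine ⟨hs', (hs'.tsum_le_tsum hle hs).trans ?_⟩
  rw [tsum_mul_left, hn]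
  exact mul_le_mul_of_nonneg_left
    (tsum_comp_le_tsum_of_inj hx (fun _ => by positivity) hσ) (by positivity)

/-- The bounded operator `(B x)(α) = w α * x (σ α)` on `ℓ²(Ω)`. -/
def backShift {Ω : Type*} (σ : Ω → Ω) (hσ : σ.Injective) (w : Ω → ℝ) (C : ℝ)
    (hw : ∀ α, |w α| ≤ C) : lp (fun _ : Ω => ℂ) 2 →L[ℂ] lp (fun _ : Ω => ℂ) 2 :=
  LinearMap.mkContinuous
    { toFun := fun x => ⟨fun α => (w α : ℂ) * x (σ α), memℓp_gen (by
        simpa using (backShift_bound σ hσ w C hw x).1)⟩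
      map_add' := fun x y => by ext α; exact mul_add _ _ _
      map_smul' := fun c x => by ext α; simp [mul_left_comm] }
    |C| (fun x => by
      refine le_of_sq_le_sq ?_ (by positivity)
      rw [mul_pow, sq_abs]
      refine le_trans (le_of_eq ?_) (backShift_bound σ hσ w C hw x).2
      simpa using lp.norm_rpow_eq_tsum (p := 2) (by norm_num)
        (⟨fun α => (w α : ℂ) * x (σ α), memℓp_gen (by
          simpa using (backShift_bound σ hσ w C hw x).1)⟩ : lp (fun _ : Ω => ℂ) 2))

theorem backShift_apply {Ω : Type*} (σ : Ω → Ω) (hσ : σ.Injective) (w : Ω → ℝ) (C : ℝ)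
    (hw : ∀ α, |w α| ≤ C) (x : lp (fun _ : Ω => ℂ) 2) (α : Ω) :
    backShift σ hσ w C hw x α = (w α : ℂ) * x (σ α) := rfl

/-- The bounded operator on `ℓ²(Ω)` with `e_α ↦ w α • e_{σ α}`. -/
def weightedShift {Ω : Type*} (σ : Ω → Ω) (hσ : σ.Injective) (w : Ω → ℝ) (C : ℝ)
    (hw : ∀ α, |w α| ≤ C) : lp (fun _ : Ω => ℂ) 2 →L[ℂ] lp (fun _ : Ω => ℂ) 2 :=
  ContinuousLinearMap.adjoint (backShift σ hσ w C hw)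

theorem weightedShift_single {Ω : Type*} [DecidableEq Ω] (σ : Ω → Ω) (hσ : σ.Injective)
    (w : Ω → ℝ) (C : ℝ) (hw : ∀ α, |w α| ≤ C) (α : Ω) :
    weightedShift σ hσ w C hw (lp.single 2 α 1) = (w α : ℂ) • lp.single 2 (σ α) 1 := by
  refine ext_inner_right ℂ fun y => ?_
  rw [weightedShift, ContinuousLinearMap.adjoint_inner_left, inner_smul_left,
    lp.inner_single_left, lp.inner_single_left, backShift_apply]
  simp

/-! ### The universal model of the polydomain -/

section Model

variable {k : ℕ} {n : Fin k → ℕ}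

/-- The words `(α_1, …, α_k)`, a monoid under componentwise concatenation. -/
abbrev MultiWord (n : Fin k → ℕ) : Type := ∀ i, FreeMonoid (Fin (n i))

/-- Polynomials in the indeterminates `Z_{i,j}`, where `Z_{s,j}` and `Z_{t,l}` commute for
`s ≠ t` and there is no other relation: the monoid algebra of the product of free monoids. -/
abbrev NCPoly (n : Fin k → ℕ) : Type := MonoidAlgebra ℂ (MultiWord n)

/-- The Hilbert space `F²(H_{n_1}) ⊗ ⋯ ⊗ F²(H_{n_k})`, with its orthonormal basis
`e_{α_1} ⊗ ⋯ ⊗ e_{α_k}` indexed by the words `(α_1, …, α_k)`. -/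
abbrev Fock (n : Fin k → ℕ) : Type := lp (fun _ : MultiWord n => ℂ) 2

/-- Multiplication of the `i`-th word by the generator `g_j` on the left. -/
def prepend (i : Fin k) (j : Fin (n i)) (α : MultiWord n) : MultiWord n :=
  Function.update α i (FreeMonoid.of j * α i)

open Classical in
/-- The basis vector `e_{α_1} ⊗ ⋯ ⊗ e_{α_k}`. -/
def basisVec (α : MultiWord n) : Fock n := lp.single 2 α 1

theorem prepend_injective (i : Fin k) (j : Fin (n i)) :
    (prepend (n := n) i j).Injective := by
  intro α β h
  funext t
  have ht := congrFun h t
  by_cases hti : t = i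
  · subst hti
    simpa [prepend] using ht
  · simpa [prepend, hti] using ht

/-- The operator `W_{i,j}`: the weighted left creation operator on the `i`-th Fock space,
tensored with the identity on the others. -/
def W (f : ∀ i, PosRegFreeHol (n i)) (m : Fin k → ℕ) (i : Fin k) (j : Fin (n i)) :
    Fock n →L[ℂ] Fock n :=
  weightedShift (prepend i j) (prepend_injective i j) (fun α => creationWeight (f i) (m i) j (α i))
    _ (fun α => abs_creationWeight_le (f i) (m i) j (α i))

theorem W_single (f : ∀ i, PosRegFreeHol (n i)) (m : Fin k → ℕ) (i : Fin k) (j : Fin (n i))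
    (α : MultiWord n) :
    W f m i j (basisVec α) =
      ((√(bCoeff (f i) (m i) (α i)) / √(bCoeff (f i) (m i) (FreeMonoid.of j * α i)) : ℝ) : ℂ) •
        basisVec (Function.update α i (FreeMonoid.of j * α i)) := by
  classical
  unfold W basisVec
  exact weightedShift_single _ _ _ _ _ _

end Model

/-! ### Noncommutative polydomains and varieties -/

section Domain

variable {k : ℕ} {n : Fin k → ℕ}
variable {H : Type*} [NormedAddCommGroup H] [InnerProductSpace ℂ H] [CompleteSpace H]

/-- `A_α` for a word `α`: `A_1 = I` and `A_{g_{j_1} ⋯ g_{j_p}} = A_{j_1} ⋯ A_{j_p}`. -/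
def wordOp {d : ℕ} (A : Fin d → H →L[ℂ] H) (α : FreeMonoid (Fin d)) : H →L[ℂ] H :=
  FreeMonoid.lift A α

/-- `A_{(α)} = A_{1,α_1} ⋯ A_{k,α_k}`. -/
def multiWordOp (A : ∀ i, Fin (n i) → H →L[ℂ] H) (α : MultiWord n) : H →L[ℂ] H :=
  (List.ofFn fun i => wordOp (A i) (α i)).prod

/-- The evaluation `q(A)` of a polynomial. -/
def evalPoly (A : ∀ i, Fin (n i) → H →L[ℂ] H) (q : NCPoly n) : H →L[ℂ] H :=
  q.coeff.sum fun α c => c • multiWordOp A α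

/-- The series `∑_α a_α A_α A_α*` converges in the weak operator topology. -/
def WeaklyConvergent {d : ℕ} (f : PosRegFreeHol d) (A : Fin d → H →L[ℂ] H) : Prop :=
  Summable fun α : FreeMonoid (Fin d) => ContinuousLinearMapWOT.ofCLM
    ((f.coeff α : ℂ) • (wordOp A α * ContinuousLinearMap.adjoint (wordOp A α)))

/-- `Φ_{f,A}(X) = ∑_α a_α A_α X A_α*`, the sum being taken in the weak operator topology. -/
def Phi {d : ℕ} (f : PosRegFreeHol d) (A : Fin d → H →L[ℂ] H) (X : H →L[ℂ] H) : H →L[ℂ] H :=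
  (∑' α : FreeMonoid (Fin d), ContinuousLinearMapWOT.ofCLM
    ((f.coeff α : ℂ) • (wordOp A α * X * ContinuousLinearMap.adjoint (wordOp A α)))).toCLM

/-- The defect mapping `Δ^p_{f,A} = (id - Φ_{f_1,A_1})^{p_1} ∘ ⋯ ∘ (id - Φ_{f_k,A_k})^{p_k}`. -/
def defect (f : ∀ i, PosRegFreeHol (n i)) (A : ∀ i, Fin (n i) → H →L[ℂ] H) (p : Fin k → ℕ)
    (X : H →L[ℂ] H) : H →L[ℂ] H :=
  (List.ofFn fun i => (fun Y : H →L[ℂ] H => Y - Phi (f i) (A i) Y)^[p i]).foldr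
    (fun g Y => g Y) X

/-- The noncommutative polydomain `D_f^m(H)`. -/
structure InPolydomain (f : ∀ i, PosRegFreeHol (n i)) (m : Fin k → ℕ)
    (A : ∀ i, Fin (n i) → H →L[ℂ] H) : Prop where
  commute : ∀ s t, s ≠ t → ∀ j l, Commute (A s j) (A t l)
  convergent : ∀ i, WeaklyConvergent (f i) (A i)
  defect_nonneg : ∀ p : Fin k → ℕ, p ≤ m → 0 ≤ defect f A p 1

/-- The noncommutative variety `V_Q(H)`. -/
structure InVariety (f : ∀ i, PosRegFreeHol (n i)) (m : Fin k → ℕ) (Q : Set (NCPoly n))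
    (A : ∀ i, Fin (n i) → H →L[ℂ] H) : Prop extends InPolydomain f m A where
  eval_eq_zero : ∀ q ∈ Q, evalPoly A q = 0

/-- `A` is pure: `Φ_{f_i,A_i}^s(I) → 0` weakly as `s → ∞`, for each `i`. -/
def IsPure (f : ∀ i, PosRegFreeHol (n i)) (A : ∀ i, Fin (n i) → H →L[ℂ] H) : Prop :=
  ∀ i, Tendsto (fun s : ℕ => ContinuousLinearMapWOT.ofCLM ((Phi (f i) (A i))^[s] 1)) atTop (𝓝 0)

/-- The closure `D` of the range of `Δ^m_{f,A}(I)^{1/2}`. -/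
def defectSpace (f : ∀ i, PosRegFreeHol (n i)) (m : Fin k → ℕ)
    (A : ∀ i, Fin (n i) → H →L[ℂ] H) : Submodule ℂ H :=
  (LinearMap.range (CFC.sqrt (defect f A m 1)).toLinearMap).topologicalClosure

end Domain

/-! ### The universal model of the variety -/

section VarietyModel

variable {k : ℕ} {n : Fin k → ℕ}

/-- The closed span of the vectors `W_{(α)} q(W) W_{(β)} 1`, `q ∈ Q`. -/
def MQ (f : ∀ i, PosRegFreeHol (n i)) (m : Fin k → ℕ) (Q : Set (NCPoly n)) :
    Submodule ℂ (Fock n) :=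
  (Submodule.span ℂ {v : Fock n | ∃ α β : MultiWord n, ∃ q ∈ Q,
    v = multiWordOp (W f m) α (evalPoly (W f m) q (multiWordOp (W f m) β
      (basisVec 1)))}).topologicalClosure

/-- `N_Q`, the orthogonal complement of `M_Q`. -/
abbrev NQ (f : ∀ i, PosRegFreeHol (n i)) (m : Fin k → ℕ) (Q : Set (NCPoly n)) :
    Submodule ℂ (Fock n) :=
  (MQ f m Q)ᗮ

/-- `S_{i,j}`, the compression of `W_{i,j}` to `N_Q`. -/
def S (f : ∀ i, PosRegFreeHol (n i)) (m : Fin k → ℕ) (Q : Set (NCPoly n)) (i : Fin k)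
    (j : Fin (n i)) : NQ f m Q →L[ℂ] NQ f m Q :=
  (NQ f m Q).orthogonalProjectionOnto ∘L W f m i j ∘L (NQ f m Q).subtypeL

end VarietyModel

/-! ### Hilbert space tensor products -/

/-- The Hilbert space tensor product: the completion of the algebraic tensor product with the
inner product `⟪x ⊗ y, x' ⊗ y'⟫ = ⟪x, x'⟫ ⟪y, y'⟫`. -/
abbrev HilbertTensor (K E : Type*) [NormedAddCommGroup K] [InnerProductSpace ℂ K]
    [NormedAddCommGroup E] [InnerProductSpace ℂ E] : Type _ :=
  UniformSpace.Completion (K ⊗[ℂ] E)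

/-- The operator `B ⊗ I_E` on the Hilbert space tensor product. -/
def ampliation {K : Type*} (E : Type*) [NormedAddCommGroup K] [InnerProductSpace ℂ K]
    [NormedAddCommGroup E] [InnerProductSpace ℂ E] (B : K →L[ℂ] K) :
    HilbertTensor K E →L[ℂ] HilbertTensor K E :=
  (B.rTensor E).completion

theorem ampliation_tmul {K E : Type*} [NormedAddCommGroup K] [InnerProductSpace ℂ K]
    [NormedAddCommGroup E] [InnerProductSpace ℂ E] (B : K →L[ℂ] K) (x : K) (y : E) :
    ampliation E B ((x ⊗ₜ[ℂ] y : K ⊗[ℂ] E) : HilbertTensor K E) =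
      ((B x ⊗ₜ[ℂ] y : K ⊗[ℂ] E) : HilbertTensor K E) := by
  simp [ampliation]

/-- There are a closed subspace `G` of `N_Q ⊗ E`, invariant under each `S_{i,j}* ⊗ I_E`, and a
unitary operator `U : H → G` with `T_{i,j}* = U* [(S_{i,j}* ⊗ I_E)|_G] U` for all `i, j`. -/
def HasModel {k : ℕ} {n : Fin k → ℕ} {H : Type*} [NormedAddCommGroup H] [InnerProductSpace ℂ H]
    [CompleteSpace H] (f : ∀ i, PosRegFreeHol (n i)) (m : Fin k → ℕ) (Q : Set (NCPoly n))
    (T : ∀ i, Fin (n i) → H →L[ℂ] H) (E : Type*) [NormedAddCommGroup E]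
    [InnerProductSpace ℂ E] : Prop :=
  ∃ (G : Submodule ℂ (HilbertTensor (NQ f m Q) E)) (_ : IsClosed (G : Set (HilbertTensor (NQ f m Q) E)))
    (hG : ∀ i j, ∀ x ∈ G, ampliation E (ContinuousLinearMap.adjoint (S f m Q i j)) x ∈ G)
    (U : H ≃ₗᵢ[ℂ] G), ∀ i j, ∀ h : H, ContinuousLinearMap.adjoint (T i j) h =
      U.symm ⟨ampliation E (ContinuousLinearMap.adjoint (S f m Q i j)) (U h),
        hG i j _ (U h).2⟩

end NCPolydomain

end

open NCPolydomain

/-!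
The theorem compares a tuple `T` with an isometry into the `E`-valued `ℓ²`-space over the words
`γ = (γ_1, …, γ_k)`, the noncommutative Poisson kernel.

Realise `N_Q ⊗ E` as the space of `E`-valued `ℓ²`-sequences orthogonal to `M_Q ⊗ E`
(`mem_range_tensorToLp_iff`). The operators `S_{i,j}* ⊗ I` act there as weighted backward shifts,
so a model of `T` over `E` is an isometry `V` of `H` into this space with
`V T_{i,j}* = (W_{i,j}* ⊗ I) V` and with range orthogonal to `M_Q ⊗ E` (`hasModel_iff`). The
intertwining relation forces `(V h)_γ = √b_γ R T_γ* h`, where `R h` is the coordinate of `V h` at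
the empty word (`apply_eq_of_intertwinesShift`). Hence an intertwining `V` is the same thing as a
bounded operator `R` with `∑_γ b_γ ‖R T_γ* h‖² = ‖h‖²` for all `h`, where `T_{s,j}` and `T_{t,l}`
commute for `s ≠ t`, and the condition on the range becomes `q(T) = 0` for `q ∈ Q`. All sums of
this kind have nonnegative terms, and are computed in `[0, ∞]`, where they can be rearranged
freely; positive operators are recovered from their quadratic forms by polarization.

The coefficients enter only through one identity. Let `b^{(r)}` be the coefficients of
`(1 - f)^{-r}`. Then `(1 - f)^{-(r+1)} = (1 - f)^{-r} + f (1 - f)^{-(r+1)}`, which is stated in tested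
form in `tsum_resolvCoeff_rec`.

* From a model to the variety: by this identity, if the operator `Z` has the quadratic form
  `∑_γ (∏_i b^{(r_i)}_{γ_i}) ‖R T_γ* h‖²`, then `Z - Φ_i(Z)` has the form with `r_i` lowered by one
  (`quad_sub_Phi_eq_kernelForm`). Starting from `I`, for which `r = m`, this shows that all the
  defects are positive. The form of `Φ_i^s(I)` is at most the part of the sum over `|γ_i| ≥ s`, a
  tail of a convergent series, so `T` is pure. For `q ∈ Q` the operator `Y = V* (· ⊗ y)` intertwines
  `q(W)` with `q(T)`, and it vanishes on `M_Q`; this gives `q(T) = 0`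
  (`evalPoly_eq_zero_of_model`).
* From the variety to a model: take `R = Δ^m(I)^{1/2}`. For a pure `T`, the map `id - Φ_i` is inverted
  on the successive defects by summation against `b_i` (`tsum_resolvCoeff_succ_quad`), and doing this
  for each `i` in turn gives `∑_γ b_γ T_γ Δ^m(I) T_γ* = I` (`tsum_quad_defect`). The relation
  `q(T) = 0` makes the range of the kernel orthogonal to `M_Q ⊗ E`
  (`inner_smulVec_eq_zero_of_mem_MQ`).
-/

open scoped InnerProductSpace

noncomputable section

namespace NCPolydomain

/-! ### Quadratic forms and weak operator convergence -/

section Quad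

variable {H : Type*} [NormedAddCommGroup H] [InnerProductSpace ℂ H]

/-- The quadratic form `x ↦ ⟪X x, x⟫` of an operator, with values in `[0, ∞]`. It is used for
positive operators, for which the truncation at `0` by `ENNReal.ofReal` is immaterial. -/
def quad (X : H →L[ℂ] H) (x : H) : ℝ≥0∞ := ENNReal.ofReal (⟪X x, x⟫_ℂ).re

theorem enorm_sq_eq_ofReal {E : Type*} [NormedAddCommGroup E] (x : E) :
    ‖x‖ₑ ^ 2 = ENNReal.ofReal (‖x‖ ^ 2) := by
  rw [← ofReal_norm, ENNReal.ofReal_pow (norm_nonneg _)]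

theorem quad_one (x : H) : quad 1 x = ‖x‖ₑ ^ 2 := by
  rw [quad, enorm_sq_eq_ofReal, ← inner_self_eq_norm_sq (𝕜 := ℂ)]
  rfl

theorem quad_ne_top (X : H →L[ℂ] H) (x : H) : quad X x ≠ ⊤ := ENNReal.ofReal_ne_top

theorem quad_le (X : H →L[ℂ] H) (x : H) : quad X x ≤ ‖X‖ₑ * ‖x‖ₑ ^ 2 := by
  rw [enorm_sq_eq_ofReal, ← ofReal_norm X, ← ENNReal.ofReal_mul (norm_nonneg _), quad]
  apply ENNReal.ofReal_le_ofReal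
  calc (⟪X x, x⟫_ℂ).re ≤ ‖⟪X x, x⟫_ℂ‖ := Complex.re_le_norm _
    _ ≤ ‖X x‖ * ‖x‖ := norm_inner_le_norm _ _
    _ ≤ ‖X‖ * ‖x‖ * ‖x‖ := by gcongr; exact X.le_opNorm x
    _ = _ := by ring

theorem inner_eq_quad {X : H →L[ℂ] H} (hX : 0 ≤ X) (x : H) :
    ⟪X x, x⟫_ℂ = (((quad X x).toReal : ℝ) : ℂ) := by
  rw [ContinuousLinearMap.nonneg_iff_isPositive] at hX
  have h := hX.inner_nonneg_left x
  rw [Complex.nonneg_iff] at h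
  rw [quad, ENNReal.toReal_ofReal h.1]
  apply Complex.ext <;> simp [h.2.symm]

theorem quad_add {X Y : H →L[ℂ] H} (hX : 0 ≤ X) (hY : 0 ≤ Y) (x : H) :
    quad (X + Y) x = quad X x + quad Y x := by
  rw [ContinuousLinearMap.nonneg_iff_isPositive] at hX hY
  have h := (Complex.nonneg_iff.1 (hX.inner_nonneg_left x)).1
  have h' := (Complex.nonneg_iff.1 (hY.inner_nonneg_left x)).1
  rw [quad, quad, quad, ← ENNReal.ofReal_add h h']
  simp

/-- Weak operator convergence can be tested on quadratic forms, by polarization. -/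
theorem tendsto_wot_iff [CompleteSpace H] {α : Type*} {l : Filter α} {A : α → H →L[ℂ] H}
    {B : H →L[ℂ] H} :
    Tendsto (fun s => ContinuousLinearMapWOT.ofCLM (A s)) l
        (𝓝 (ContinuousLinearMapWOT.ofCLM B)) ↔
      ∀ x, Tendsto (fun s => ⟪A s x, x⟫_ℂ) l (𝓝 ⟪B x, x⟫_ℂ) := by
  have hpol : ∀ (X : H →L[ℂ] H) (x y : H), ⟪X y, x⟫_ℂ =
      (⟪X (x + y), x + y⟫_ℂ - ⟪X (x - y), x - y⟫_ℂ + Complex.I * ⟪X (x + Complex.I • y),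
        x + Complex.I • y⟫_ℂ - Complex.I * ⟪X (x - Complex.I • y), x - Complex.I • y⟫_ℂ) / 4 :=
    fun X x y => inner_map_polarization (X : H →ₗ[ℂ] H) x y
  have hconj : ∀ x y, Tendsto (fun s => ⟪A s x, y⟫_ℂ) l (𝓝 ⟪B x, y⟫_ℂ) ↔
      Tendsto (fun s => ⟪y, A s x⟫_ℂ) l (𝓝 ⟪y, B x⟫_ℂ) := by
    intro x y
    constructor <;> intro h <;>
    · have := (Complex.continuous_conj.tendsto _).comp h
      simpa only [Function.comp_def, inner_conj_symm] using this
  rw [ContinuousLinearMapWOT.tendsto_iff_forall_inner_apply_tendsto]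
  refine ⟨fun h x => (hconj x x).2 (h x x), fun h x y => (hconj x y).1 ?_⟩
  rw [hpol, funext fun s => hpol (A s) y x]
  exact ((((h _).sub (h _)).add ((h _).const_mul _)).sub ((h _).const_mul _)).div_const _

theorem hasSum_wot_iff [CompleteSpace H] {ι : Type*} {A : ι → H →L[ℂ] H} {B : H →L[ℂ] H} :
    HasSum (fun i => ContinuousLinearMapWOT.ofCLM (A i)) (ContinuousLinearMapWOT.ofCLM B) ↔
      ∀ x, HasSum (fun i => ⟪A i x, x⟫_ℂ) ⟪B x, x⟫_ℂ := by
  have hs : ∀ s : Finset ι, ∑ i ∈ s, ContinuousLinearMapWOT.ofCLM (A i) =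
      ContinuousLinearMapWOT.ofCLM (∑ i ∈ s, A i) := fun s =>
    (map_sum (ContinuousLinearMapWOT.addEquiv (σ := RingHom.id ℂ) (E := H) (F := H)).symm A s).symm
  simp only [HasSum, hs]
  rw [tendsto_wot_iff]
  simp only [sum_apply, sum_inner]

theorem hasSum_ofReal_toReal_iff {ι : Type*} {g : ι → ℝ≥0∞} (hg : ∀ i, g i ≠ ⊤) {c : ℝ≥0∞}
    (hc : c ≠ ⊤) :
    HasSum (fun i => ((((g i).toReal : ℝ)) : ℂ)) ((c.toReal : ℝ) : ℂ) ↔ ∑' i, g i = c := by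
  rw [Complex.hasSum_ofReal]
  constructor
  · intro h
    have h2 : HasSum (fun i => (g i).toNNReal) c.toNNReal := by
      rw [← NNReal.hasSum_coe]; exact h
    rw [← ENNReal.hasSum_coe] at h2
    simp only [ENNReal.coe_toNNReal (hg _), ENNReal.coe_toNNReal hc] at h2
    exact h2.tsum_eq
  · rintro rfl
    rw [ENNReal.tsum_toReal_eq hg]
    exact ENNReal.hasSum_toReal hc

/-- For positive operators, weak operator convergence of a series amounts to an identity between
quadratic forms in `[0, ∞]`. -/
theorem hasSum_wot_iff_quad [CompleteSpace H] {ι : Type*} {A : ι → H →L[ℂ] H}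
    {B : H →L[ℂ] H} (hA : ∀ i, 0 ≤ A i) (hB : 0 ≤ B) :
    HasSum (fun i => ContinuousLinearMapWOT.ofCLM (A i)) (ContinuousLinearMapWOT.ofCLM B) ↔
      ∀ x, ∑' i, quad (A i) x = quad B x := by
  rw [hasSum_wot_iff]
  refine forall_congr' fun x => ?_
  simp only [inner_eq_quad (hA _), inner_eq_quad hB]
  exact hasSum_ofReal_toReal_iff (fun i => quad_ne_top _ _) (quad_ne_top _ _)

theorem tendsto_wot_zero_iff_quad [CompleteSpace H] {A : ℕ → H →L[ℂ] H} (hA : ∀ s, 0 ≤ A s) :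
    Tendsto (fun s => ContinuousLinearMapWOT.ofCLM (A s)) atTop (𝓝 0) ↔
      ∀ x, Tendsto (fun s => quad (A s) x) atTop (𝓝 0) := by
  rw [← ContinuousLinearMapWOT.ofCLM_zero, tendsto_wot_iff]
  refine forall_congr' fun x => ?_
  simp only [inner_eq_quad (hA _), zero_apply, inner_zero_left]
  rw [← Complex.ofReal_zero, tendsto_ofReal_iff, ← ENNReal.toReal_zero,
    ENNReal.tendsto_toReal_iff (fun i => quad_ne_top _ _) ENNReal.zero_ne_top]

/-- The operator `x ↦ (C_i x)_i` into the `E`-valued `ℓ²`, for a family with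
`∑_i ‖C_i x‖² ≤ M ‖x‖²`. -/
def colOp {ι : Type*} {E : Type*} [NormedAddCommGroup E] [InnerProductSpace ℂ E]
    (C : ι → H →L[ℂ] E) (M : ℝ) (hC : ∀ x, ∑' i, ‖C i x‖ₑ ^ 2 ≤ ENNReal.ofReal (M * ‖x‖ ^ 2)) :
    H →L[ℂ] lp (fun _ : ι => E) 2 :=
  have hs : ∀ x, Summable fun i => ‖C i x‖ ^ 2 := fun x => by
    have h := ne_top_of_le_ne_top ENNReal.ofReal_ne_top (hC x)
    simp only [enorm_sq_eq_ofReal] at h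
    have h2 := ENNReal.summable_toReal h
    simpa using h2
  LinearMap.mkContinuous
    { toFun := fun x => ⟨fun i => C i x, memℓp_gen (by simpa using hs x)⟩
      map_add' := fun x y => by ext i; exact map_add _ _ _
      map_smul' := fun c x => by ext i; exact map_smul _ _ _ }
    (√ (max M 0)) (fun x => by
      refine le_of_sq_le_sq ?_ (by positivity)
      rw [mul_pow, Real.sq_sqrt (le_max_right _ _)]
      have hn := lp.norm_rpow_eq_tsum (p := 2) (by norm_num)
        (⟨fun i => C i x, memℓp_gen (by simpa using hs x)⟩ : lp (fun _ : ι => E) 2)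
      simp only [ENNReal.toReal_ofNat, Real.rpow_ofNat] at hn
      refine hn.trans_le ?_
      have h := hC x
      simp only [enorm_sq_eq_ofReal] at h
      rw [← ENNReal.ofReal_tsum_of_nonneg (fun _ => by positivity) (hs x)] at h
      refine ((ENNReal.ofReal_le_ofReal_iff' ).1 h).elim (fun h => h.trans ?_)
        (fun h => h.trans (by positivity))
      gcongr
      exact le_max_left _ _)

theorem lp_enorm_sq {ι : Type*} {E : Type*} [NormedAddCommGroup E]
    (F : lp (fun _ : ι => E) 2) : ‖F‖ₑ ^ 2 = ∑' i, ‖F i‖ₑ ^ 2 := by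
  have hn := lp.norm_rpow_eq_tsum (p := 2) (by norm_num) F
  have hs := (lp.memℓp F).summable (by norm_num)
  simp only [ENNReal.toReal_ofNat, Real.rpow_ofNat] at hn hs
  simp only [enorm_sq_eq_ofReal]
  rw [hn, ENNReal.ofReal_tsum_of_nonneg (fun _ => by positivity) hs]

variable [CompleteSpace H]

theorem quad_adjoint_comp {E : Type*} [NormedAddCommGroup E] [InnerProductSpace ℂ E]
    [CompleteSpace E] (C : H →L[ℂ] E) (x : H) :
    quad (ContinuousLinearMap.adjoint C ∘L C) x = ‖C x‖ₑ ^ 2 := by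
  rw [quad, enorm_sq_eq_ofReal, ContinuousLinearMap.comp_apply,
    ContinuousLinearMap.adjoint_inner_left, ← inner_self_eq_norm_sq (𝕜 := ℂ)]
  rfl

theorem quad_conj (A X : H →L[ℂ] H) (x : H) :
    quad (A * X * ContinuousLinearMap.adjoint A) x = quad X (ContinuousLinearMap.adjoint A x) := by
  rw [quad, quad, mul_apply_eq_comp, mul_apply_eq_comp,
    ← ContinuousLinearMap.adjoint_inner_right]

/-- A bounded sum of squares of operators is the quadratic form of a positive operator. -/
theorem exists_quad_eq_tsum {ι : Type*} {E : Type*} [NormedAddCommGroup E]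
    [InnerProductSpace ℂ E] [CompleteSpace E] (C : ι → H →L[ℂ] E) (M : ℝ)
    (hC : ∀ x, ∑' i, ‖C i x‖ₑ ^ 2 ≤ ENNReal.ofReal (M * ‖x‖ ^ 2)) :
    ∃ Z : H →L[ℂ] H, 0 ≤ Z ∧ ∀ x, quad Z x = ∑' i, ‖C i x‖ₑ ^ 2 := by
  refine ⟨ContinuousLinearMap.adjoint (colOp C M hC) ∘L colOp C M hC, ?_, fun x => ?_⟩
  · rw [ContinuousLinearMap.nonneg_iff_isPositive]
    exact ContinuousLinearMap.isPositive_adjoint_comp_self _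
  · rw [quad_adjoint_comp, lp_enorm_sq]
    rfl

theorem enorm_sqrt_apply {X : H →L[ℂ] H} (hX : 0 ≤ X) (x : H) :
    ‖CFC.sqrt X x‖ₑ ^ 2 = quad X x := by
  have h0 : 0 ≤ CFC.sqrt X := CFC.sqrt_nonneg X
  have hsa : ContinuousLinearMap.adjoint (CFC.sqrt X) = CFC.sqrt X :=
    ((ContinuousLinearMap.nonneg_iff_isPositive _).1 h0).isSelfAdjoint.adjoint_eq
  rw [← quad_adjoint_comp, hsa]
  congr 1
  exact CFC.sqrt_mul_sqrt_self X hX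

end Quad

/-! ### The recursion for the coefficients `b_α` -/

section Coeff

variable {d : ℕ}

/-- The coefficients of the formal power series `(1 - f)^{-r}`, with values in `[0, ∞]`. For
`r ≥ 1` they are the numbers `bCoeff f r α`; the case `r = 0`, not covered by `bCoeff`, is the
series `1`. -/
def resolvCoeff (f : PosRegFreeHol d) : ℕ → FreeMonoid (Fin d) → ℝ≥0∞
  | 0, α => Set.indicator {1} 1 α
  | r + 1, α => ENNReal.ofReal (bCoeff f (r + 1) α)

theorem resolvCoeff_ne_top (f : PosRegFreeHol d) (r : ℕ) (α : FreeMonoid (Fin d)) :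
    resolvCoeff f r α ≠ ⊤ := by
  cases r with
  | zero =>
    refine ne_top_of_le_ne_top ENNReal.one_ne_top ?_
    exact Set.indicator_le_self _ _ _
  | succ r => exact ENNReal.ofReal_ne_top

theorem tsum_resolvCoeff_zero (f : PosRegFreeHol d) (F : FreeMonoid (Fin d) → ℝ≥0∞) :
    ∑' α, resolvCoeff f 0 α * F α = F 1 := by
  rw [tsum_eq_single 1]
  · simp [resolvCoeff]
  · intro α hα
    simp [resolvCoeff, hα]

/-- The contribution of a factorization of a word, given by the list `L` of its factors, to the
coefficient of that word in `(1 - f)^{-(r+1)}`. It vanishes if `L` contains an empty factor. -/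
def factorWeight (f : PosRegFreeHol d) (r : ℕ) (L : List (List (Fin d))) : ℝ≥0∞ :=
  ENNReal.ofReal (L.map fun γ => f.coeff (FreeMonoid.ofList γ)).prod *
    ((L.length + r).choose r : ℕ)

/-- A sum over words with the coefficients of `(1 - f)^{-(r+1)}` is a sum over lists of words: the
lists of nonempty words correspond to the words with a composition of their length, and the other
lists have weight `0`. -/
theorem tsum_resolvCoeff_succ (f : PosRegFreeHol d) (r : ℕ) (F : FreeMonoid (Fin d) → ℝ≥0∞) :
    ∑' α, resolvCoeff f (r + 1) α * F α =
      ∑' L, factorWeight f r L * F (FreeMonoid.ofList L.flatten) := by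
  let j : (Σ l : List (Fin d), Composition l.length) → List (List (Fin d)) :=
    fun p => p.1.splitWrtComposition p.2
  have hj : j.Injective := by
    rintro ⟨l, c⟩ ⟨l', c'⟩ h
    simp only [j] at h
    have hl : l = l' := by
      rw [← List.flatten_splitWrtComposition l c, h, List.flatten_splitWrtComposition]
    subst hl
    have : c = c' := Composition.ext (by
      rw [← List.map_length_splitWrtComposition l c, h, List.map_length_splitWrtComposition])
    rw [this]
  rw [← hj.tsum_eq]
  · rw [ENNReal.tsum_sigma']
    refine tsum_congr fun α => ?_
    rw [tsum_fintype, resolvCoeff, bCoeff, ENNReal.ofReal_sum_of_nonneg, Finset.sum_mul]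
    · refine Finset.sum_congr rfl fun c _ => ?_
      rw [ENNReal.ofReal_mul (prod_coeff_nonneg f _)]
      change _ = factorWeight f r (α.toList.splitWrtComposition c) *
        F (FreeMonoid.ofList (α.toList.splitWrtComposition c).flatten)
      rw [factorWeight, List.flatten_splitWrtComposition, List.length_splitWrtComposition,
        ENNReal.ofReal_natCast]
      rfl
    · exact fun _ _ => mul_nonneg (prod_coeff_nonneg f _) (Nat.cast_nonneg _)
  · intro L hL
    have hne : [] ∉ L := fun h => hL (by
      have : (L.map fun γ => f.coeff (FreeMonoid.ofList γ)).prod = 0 :=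
        List.prod_eq_zero (List.mem_map.2 ⟨[], h, f.coeff_one⟩)
      simp [factorWeight, this])
    refine ⟨⟨L.flatten, ⟨L.map List.length, ?_, ?_⟩⟩, ?_⟩
    · intro i hi
      obtain ⟨γ, hγ, rfl⟩ := List.mem_map.1 hi
      exact List.length_pos_iff.2 (fun h => hne (h ▸ hγ))
    · exact List.length_flatten.symm
    · exact List.splitWrtComposition_flatten _ _ rfl

theorem tsum_list_eq {α : Type*} (g : List α → ℝ≥0∞) :
    ∑' L, g L = g [] + ∑' a, ∑' L, g (a :: L) := by
  have he : ({[]} : Set (List α))ᶜ = Set.range (fun p : α × List α => p.1 :: p.2) := by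
    ext L
    cases L <;> simp
  have hi : (fun p : α × List α => p.1 :: p.2).Injective := fun p q h => by
    simpa [Prod.ext_iff] using h
  rw [← ENNReal.tsum_prod (f := fun a L => g (a :: L)), ← tsum_range (f := g) hi, ← he,
    ← ENNReal.summable.tsum_add_tsum_compl (s := {[]}) ENNReal.summable, tsum_singleton]

/-- The identity `(1 - f)^{-(r+1)} = (1 - f)^{-r} + f (1 - f)^{-(r+1)}` of formal power series,
tested against an arbitrary function on words. -/
theorem tsum_resolvCoeff_rec (f : PosRegFreeHol d) (r : ℕ) (F : FreeMonoid (Fin d) → ℝ≥0∞) :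
    ∑' γ, resolvCoeff f (r + 1) γ * F γ = ∑' γ, resolvCoeff f r γ * F γ +
      ∑' α, ENNReal.ofReal (f.coeff α) * ∑' β, resolvCoeff f (r + 1) β * F (α * β) := by
  have hcons : ∀ r (α : List (Fin d)) L, factorWeight f r (α :: L) =
      ENNReal.ofReal (f.coeff (FreeMonoid.ofList α)) *
        (ENNReal.ofReal (L.map fun γ => f.coeff (FreeMonoid.ofList γ)).prod *
          ((L.length + 1 + r).choose r : ℕ)) := by
    intro r α L
    rw [factorWeight, List.map_cons, List.prod_cons, ENNReal.ofReal_mul (f.coeff_nonneg _),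
      mul_assoc, List.length_cons]
  have hstep : ∑' α, ENNReal.ofReal (f.coeff α) * ∑' β, resolvCoeff f (r + 1) β * F (α * β) =
      ∑' α : List (Fin d), ∑' L, ENNReal.ofReal (f.coeff (FreeMonoid.ofList α)) *
        factorWeight f r L * F (FreeMonoid.ofList (α :: L).flatten) := by
    refine tsum_congr fun α => ?_
    rw [tsum_resolvCoeff_succ f r fun β => F (α * β), ← ENNReal.tsum_mul_left]
    refine tsum_congr fun L => ?_
    rw [mul_assoc]
    rfl
  rw [hstep, tsum_resolvCoeff_succ, tsum_list_eq (α := List (Fin d))]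
  cases r with
  | zero =>
    rw [tsum_resolvCoeff_zero]
    congr 1
    · simp [factorWeight]
    · refine tsum_congr fun α => tsum_congr fun L => ?_
      rw [hcons]
      simp [factorWeight]
  | succ r =>
    rw [tsum_resolvCoeff_succ f r, tsum_list_eq (α := List (Fin d)), add_assoc, ← ENNReal.tsum_add]
    congr 1
    · simp [factorWeight]
    · refine tsum_congr fun α => ?_
      rw [← ENNReal.tsum_add]
      refine tsum_congr fun L => ?_
      rw [hcons, hcons, ← add_mul, factorWeight, ← mul_add, ← mul_add, ← Nat.cast_add]
      congr 5
      -- What remains is Pascal's rule, for a list with first factor `α` and further factors `L`.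
      have h1 : L.length + 1 + (r + 1) = (L.length + 1 + r) + 1 := by ring
      have h2 : L.length + (r + 1) = L.length + 1 + r := by ring
      rw [h1, h2, Nat.choose_succ_succ]

theorem tsum_resolvCoeff_le_succ (f : PosRegFreeHol d) (r : ℕ) (F : FreeMonoid (Fin d) → ℝ≥0∞) :
    ∑' γ, resolvCoeff f r γ * F γ ≤ ∑' γ, resolvCoeff f (r + 1) γ * F γ := by
  rw [tsum_resolvCoeff_rec]
  exact le_self_add

theorem bCoeff_pos (f : PosRegFreeHol d) (m : ℕ) (α : FreeMonoid (Fin d)) : 0 < bCoeff f m α := by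
  induction α using FreeMonoid.inductionOn' with
  | one => rw [bCoeff_one]; exact one_pos
  | of_mul j α ih => exact (mul_pos (f.coeff_of_pos j) ih).trans_le (coeff_mul_bCoeff_le f m j α)

end Coeff

/-! ### Operators indexed by words -/

section Words

/-- The ordered product is multiplicative on families whose components of different index commute. -/
theorem prod_ofFn_mul {M : Type*} [Monoid M] {k : ℕ} (u v : Fin k → M)
    (h : ∀ i j, i ≠ j → Commute (u i) (v j)) :
    (List.ofFn fun i => u i * v i).prod = (List.ofFn u).prod * (List.ofFn v).prod := by
  induction k with
  | zero => simp
  | succ k ih =>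
    have hc : Commute (v 0) (List.ofFn fun i : Fin k => u i.succ).prod := by
      refine Commute.list_prod_right _ _ fun y hy => ?_
      obtain ⟨i, rfl⟩ := (List.mem_ofFn' _ _).1 hy
      exact (h _ _ (Fin.succ_ne_zero i)).symm
    simp only [List.ofFn_succ, List.prod_cons]
    rw [ih (fun i => u i.succ) (fun i => v i.succ)
      fun i j hij => h _ _ (fun h' => hij (Fin.succ_injective _ h'))]
    simp only [mul_assoc]
    rw [← mul_assoc (v 0), hc.eq, mul_assoc]

/-- A property of families of monoid elements can be proved by multiplying by one component at a
time. -/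
theorem pi_mulSingle_mul_induction {ι : Type*} [Fintype ι] [DecidableEq ι] {M : ι → Type*}
    [∀ i, Monoid (M i)] (p : (∀ i, M i) → Prop) (one : p 1)
    (mul : ∀ i (a : M i) γ, p γ → p (Pi.mulSingle i a * γ)) (δ : ∀ i, M i) : p δ := by
  classical
  have key : ∀ s : Finset ι, p fun i => if i ∈ s then δ i else 1 := by
    intro s
    induction s using Finset.induction_on with
    | empty => simpa using! one
    | insert i s hi ih =>
      convert mul i (δ i) _ ih using 1
      funext t
      by_cases ht : t = i
      · subst ht; simp [hi]
      · simp [ht]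
  simpa using key Finset.univ

variable {H : Type*} [NormedAddCommGroup H] [InnerProductSpace ℂ H]
variable {k : ℕ} {n : Fin k → ℕ}

theorem wordOp_mul {d : ℕ} (A : Fin d → H →L[ℂ] H) (α β : FreeMonoid (Fin d)) :
    wordOp A (α * β) = wordOp A α * wordOp A β := map_mul _ _ _

theorem wordOp_one {d : ℕ} (A : Fin d → H →L[ℂ] H) : wordOp A 1 = 1 := map_one _

theorem wordOp_of {d : ℕ} (A : Fin d → H →L[ℂ] H) (j : Fin d) :
    wordOp A (FreeMonoid.of j) = A j := FreeMonoid.lift_eval_of _ _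

theorem commute_wordOp {d e : ℕ} {A : Fin d → H →L[ℂ] H}
    {B : Fin e → H →L[ℂ] H} (h : ∀ j l, Commute (A j) (B l)) (α : FreeMonoid (Fin d))
    (β : FreeMonoid (Fin e)) : Commute (wordOp A α) (wordOp B β) := by
  have hB : ∀ j, Commute (A j) (wordOp B β) := fun j => by
    induction β using FreeMonoid.inductionOn' with
    | one => exact Commute.one_right _
    | of_mul l β ih => exact (wordOp_mul B _ β ▸ ((wordOp_of B l).symm ▸ h j l).mul_right ih)
  induction α using FreeMonoid.inductionOn' with
  | one => exact Commute.one_left _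
  | of_mul j α ih => exact (wordOp_mul A _ α ▸ ((wordOp_of A j).symm ▸ hB j).mul_left ih)

theorem adjoint_one_eq [CompleteSpace H] :
    ContinuousLinearMap.adjoint (1 : H →L[ℂ] H) = 1 :=
  ContinuousLinearMap.adjoint_id

theorem adjoint_mul_apply [CompleteSpace H] (A B : H →L[ℂ] H) (x : H) :
    ContinuousLinearMap.adjoint (A * B) x =
      ContinuousLinearMap.adjoint B (ContinuousLinearMap.adjoint A x) := by
  rw [ContinuousLinearMap.mul_def, ContinuousLinearMap.adjoint_comp]
  rfl

theorem multiWordOp_one (A : ∀ i, Fin (n i) → H →L[ℂ] H) : multiWordOp A 1 = 1 := by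
  rw [multiWordOp]
  refine List.prod_eq_one fun x hx => ?_
  obtain ⟨i, rfl⟩ := (List.mem_ofFn' _ _).1 hx
  exact wordOp_one _

theorem multiWordOp_mulSingle (A : ∀ i, Fin (n i) → H →L[ℂ] H) (i : Fin k)
    (α : FreeMonoid (Fin (n i))) : multiWordOp A (Pi.mulSingle i α) = wordOp (A i) α := by
  rw [multiWordOp, List.ofFn_eq_map, List.prod_map_eq_pow_single i,
    List.count_eq_one_of_mem (List.nodup_finRange k) (List.mem_finRange i), pow_one,
    Pi.mulSingle_eq_same]
  intro j hj _
  rw [Pi.mulSingle_eq_of_ne hj, wordOp_one]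

theorem multiWordOp_mul {A : ∀ i, Fin (n i) → H →L[ℂ] H}
    (hA : ∀ s t, s ≠ t → ∀ j l, Commute (A s j) (A t l)) (α β : MultiWord n) :
    multiWordOp A (α * β) = multiWordOp A α * multiWordOp A β := by
  rw [multiWordOp, multiWordOp, multiWordOp, ← prod_ofFn_mul]
  · congr 2
    funext i
    exact wordOp_mul _ _ _
  · exact fun i j hij => commute_wordOp (hA i j hij) _ _

theorem adjoint_multiWordOp_mul [CompleteSpace H] {A : ∀ i, Fin (n i) → H →L[ℂ] H}
    (hA : ∀ s t, s ≠ t → ∀ j l, Commute (A s j) (A t l)) (α β : MultiWord n) (x : H) :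
    ContinuousLinearMap.adjoint (multiWordOp A (α * β)) x =
      ContinuousLinearMap.adjoint (multiWordOp A β)
        (ContinuousLinearMap.adjoint (multiWordOp A α) x) := by
  rw [multiWordOp_mul hA, adjoint_mul_apply]

theorem prepend_eq_mul (i : Fin k) (j : Fin (n i)) (α : MultiWord n) :
    prepend i j α = Pi.mulSingle i (FreeMonoid.of j) * α := by
  funext t
  by_cases ht : t = i
  · subst ht; simp [prepend]
  · simp [prepend, ht]

theorem multiWordOp_prepend {A : ∀ i, Fin (n i) → H →L[ℂ] H}
    (hA : ∀ s t, s ≠ t → ∀ j l, Commute (A s j) (A t l)) (i : Fin k) (j : Fin (n i))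
    (α : MultiWord n) : multiWordOp A (prepend i j α) = A i j * multiWordOp A α := by
  rw [prepend_eq_mul, multiWordOp_mul hA, multiWordOp_mulSingle, wordOp_of]

end Words

/-! ### The maps `Φ` on positive operators -/

section Phi

variable {H : Type*} [NormedAddCommGroup H] [InnerProductSpace ℂ H] [CompleteSpace H]
variable {d : ℕ}

theorem phi_term_nonneg (f : PosRegFreeHol d) (A : Fin d → H →L[ℂ] H) {X : H →L[ℂ] H}
    (hX : 0 ≤ X) (α : FreeMonoid (Fin d)) :
    0 ≤ (f.coeff α : ℂ) • (wordOp A α * X * ContinuousLinearMap.adjoint (wordOp A α)) := by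
  rw [ContinuousLinearMap.nonneg_iff_isPositive] at hX ⊢
  refine ContinuousLinearMap.IsPositive.smul_of_nonneg ?_ ?_
  · have := hX.conj_adjoint (wordOp A α)
    rwa [← ContinuousLinearMap.comp_assoc] at this
  · exact_mod_cast f.coeff_nonneg α

theorem quad_phi_term (f : PosRegFreeHol d) (A : Fin d → H →L[ℂ] H) (X : H →L[ℂ] H)
    (α : FreeMonoid (Fin d)) (x : H) :
    quad ((f.coeff α : ℂ) • (wordOp A α * X * ContinuousLinearMap.adjoint (wordOp A α))) x =
      ENNReal.ofReal (f.coeff α) * quad X (ContinuousLinearMap.adjoint (wordOp A α) x) := by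
  rw [← quad_conj, quad, quad, ← ENNReal.ofReal_mul (f.coeff_nonneg α)]
  simp

theorem hasSum_phi_iff (f : PosRegFreeHol d) (A : Fin d → H →L[ℂ] H) {X Z : H →L[ℂ] H}
    (hX : 0 ≤ X) (hZ : 0 ≤ Z) :
    HasSum (fun α : FreeMonoid (Fin d) => ContinuousLinearMapWOT.ofCLM
        ((f.coeff α : ℂ) • (wordOp A α * X * ContinuousLinearMap.adjoint (wordOp A α))))
      (ContinuousLinearMapWOT.ofCLM Z) ↔
    ∀ x, ∑' α, ENNReal.ofReal (f.coeff α) *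
      quad X (ContinuousLinearMap.adjoint (wordOp A α) x) = quad Z x := by
  rw [hasSum_wot_iff_quad (phi_term_nonneg f A hX) hZ]
  simp only [quad_phi_term]

theorem Phi_eq_of_quad {f : PosRegFreeHol d} {A : Fin d → H →L[ℂ] H} {X Z : H →L[ℂ] H}
    (hX : 0 ≤ X) (hZ : 0 ≤ Z) (h : ∀ x, ∑' α, ENNReal.ofReal (f.coeff α) *
      quad X (ContinuousLinearMap.adjoint (wordOp A α) x) = quad Z x) : Phi f A X = Z := by
  rw [Phi, ((hasSum_phi_iff f A hX hZ).2 h).tsum_eq]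

theorem weaklyConvergent_of_quad {f : PosRegFreeHol d} {A : Fin d → H →L[ℂ] H} {Z : H →L[ℂ] H}
    (hZ : 0 ≤ Z) (h : ∀ x, ∑' α, ENNReal.ofReal (f.coeff α) *
      quad 1 (ContinuousLinearMap.adjoint (wordOp A α) x) = quad Z x) : WeaklyConvergent f A := by
  have := ((hasSum_phi_iff f A zero_le_one hZ).2 h).summable
  simp only [mul_one] at this
  exact this

open scoped ComplexOrder in
theorem hasSum_wot_nonneg {ι : Type*} {A : ι → H →L[ℂ] H} {B : H →L[ℂ] H} (hA : ∀ i, 0 ≤ A i)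
    (h : HasSum (fun i => ContinuousLinearMapWOT.ofCLM (A i)) (ContinuousLinearMapWOT.ofCLM B)) :
    0 ≤ B := by
  rw [ContinuousLinearMap.nonneg_iff_isPositive, ContinuousLinearMap.isPositive_iff_complex]
  rw [hasSum_wot_iff] at h
  intro x
  have hx : 0 ≤ ⟪B x, x⟫_ℂ := by
    refine (h x).nonneg fun i => ?_
    exact ((ContinuousLinearMap.nonneg_iff_isPositive _).1 (hA i)).inner_nonneg_left x
  rw [Complex.nonneg_iff] at hx
  exact ⟨Complex.ext (by simp) (by simp [hx.2]), hx.1⟩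

/-- If `∑ a_α A_α A_α*` converges weakly, then so does `∑ a_α A_α X A_α*` for positive `X`; the
sum `Φ(X)` is positive, and its quadratic form is the sum of the quadratic forms. -/
theorem quad_Phi {f : PosRegFreeHol d} {A : Fin d → H →L[ℂ] H} (hA : WeaklyConvergent f A)
    {X : H →L[ℂ] H} (hX : 0 ≤ X) :
    0 ≤ Phi f A X ∧ ∀ x, quad (Phi f A X) x = ∑' α, ENNReal.ofReal (f.coeff α) *
      quad X (ContinuousLinearMap.adjoint (wordOp A α) x) := by
  obtain ⟨Y, hY⟩ := hA
  have hY' : HasSum (fun α : FreeMonoid (Fin d) => ContinuousLinearMapWOT.ofCLM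
      ((f.coeff α : ℂ) • (wordOp A α * 1 * ContinuousLinearMap.adjoint (wordOp A α))))
      (ContinuousLinearMapWOT.ofCLM Y.toCLM) := by simpa only [mul_one] using hY
  have hY0 := hasSum_wot_nonneg (phi_term_nonneg f A zero_le_one) hY'
  rw [hasSum_phi_iff f A zero_le_one hY0] at hY'
  have hterm : ∀ α x, ‖((√(f.coeff α) : ℂ) • (CFC.sqrt X *
      ContinuousLinearMap.adjoint (wordOp A α))) x‖ₑ ^ 2 = ENNReal.ofReal (f.coeff α) *
        quad X (ContinuousLinearMap.adjoint (wordOp A α) x) := by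
    intro α x
    rw [smul_apply, enorm_smul, mul_pow, mul_apply_eq_comp, enorm_sqrt_apply hX,
      enorm_sq_eq_ofReal, Complex.norm_real, Real.norm_eq_abs, sq_abs,
      Real.sq_sqrt (f.coeff_nonneg α)]
  obtain ⟨Z, hZ, hq⟩ := exists_quad_eq_tsum (fun α => (√(f.coeff α) : ℂ) • (CFC.sqrt X *
      ContinuousLinearMap.adjoint (wordOp A α))) (‖X‖ * ‖Y.toCLM‖) (by
    intro x
    simp only [hterm]
    calc _ ≤ ∑' α, ‖X‖ₑ * (ENNReal.ofReal (f.coeff α) *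
          quad 1 (ContinuousLinearMap.adjoint (wordOp A α) x)) := by
          refine ENNReal.tsum_le_tsum fun α => ?_
          rw [mul_left_comm, quad_one]
          gcongr
          exact quad_le _ _
      _ = ‖X‖ₑ * quad Y.toCLM x := by rw [ENNReal.tsum_mul_left, hY']
      _ ≤ ‖X‖ₑ * (‖Y.toCLM‖ₑ * ‖x‖ₑ ^ 2) := by gcongr; exact quad_le _ _
      _ = _ := by
        rw [enorm_sq_eq_ofReal, ← ofReal_norm, ← ofReal_norm, ← mul_assoc,
          ← ENNReal.ofReal_mul (norm_nonneg _), ← ENNReal.ofReal_mul (by positivity)])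
  simp only [hterm] at hq
  rw [Phi_eq_of_quad hX hZ fun x => (hq x).symm]
  exact ⟨hZ, hq⟩

theorem Phi_iterate_nonneg {f : PosRegFreeHol d} {A : Fin d → H →L[ℂ] H}
    (hA : WeaklyConvergent f A) {X : H →L[ℂ] H} (hX : 0 ≤ X) (s : ℕ) : 0 ≤ (Phi f A)^[s] X := by
  induction s with
  | zero => exact hX
  | succ s ih =>
    rw [Function.iterate_succ_apply']
    exact (quad_Phi hA ih).1

theorem quad_Phi_iterate_succ {f : PosRegFreeHol d} {A : Fin d → H →L[ℂ] H}
    (hA : WeaklyConvergent f A) {X : H →L[ℂ] H} (hX : 0 ≤ X) (s : ℕ) (x : H) :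
    quad ((Phi f A)^[s + 1] X) x = ∑' α, ENNReal.ofReal (f.coeff α) *
      quad ((Phi f A)^[s] X) (ContinuousLinearMap.adjoint (wordOp A α) x) := by
  rw [Function.iterate_succ_apply']
  exact (quad_Phi hA (Phi_iterate_nonneg hA hX s)).2 x

theorem quad_Phi_iterate_le {f : PosRegFreeHol d} {A : Fin d → H →L[ℂ] H}
    (hA : WeaklyConvergent f A) {X : H →L[ℂ] H} (hX : 0 ≤ X) (s : ℕ) (x : H) :
    quad ((Phi f A)^[s] X) x ≤ ‖X‖ₑ * quad ((Phi f A)^[s] 1) x := by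
  induction s generalizing x with
  | zero => simpa [quad_one] using quad_le X x
  | succ s ih =>
    rw [quad_Phi_iterate_succ hA hX, quad_Phi_iterate_succ hA zero_le_one,
      ← ENNReal.tsum_mul_left]
    refine ENNReal.tsum_le_tsum fun α => ?_
    rw [mul_left_comm]
    gcongr
    exact ih _

theorem isPure_iff_quad {k : ℕ} {n : Fin k → ℕ} {f : ∀ i, PosRegFreeHol (n i)}
    {T : ∀ i, Fin (n i) → H →L[ℂ] H} (hT : ∀ i, WeaklyConvergent (f i) (T i)) :
    IsPure f T ↔ ∀ i x, Tendsto (fun s => quad ((Phi (f i) (T i))^[s] 1) x) atTop (𝓝 0) :=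
  forall_congr' fun i => tendsto_wot_zero_iff_quad fun s =>
    Phi_iterate_nonneg (hT i) zero_le_one s

end Phi

/-! ### Reconstruction of the identity from the defect of a pure tuple -/

section Reconstruction

variable {H : Type*} [NormedAddCommGroup H] [InnerProductSpace ℂ H] [CompleteSpace H]

/-- Every word that occurs in `f` is nonempty. -/
theorem one_le_length_of_coeff_ne_zero {d : ℕ} (f : PosRegFreeHol d) {α : FreeMonoid (Fin d)}
    (h : ENNReal.ofReal (f.coeff α) ≠ 0) : 1 ≤ α.length := by
  rw [Nat.one_le_iff_ne_zero]
  intro h0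
  rw [FreeMonoid.length_eq_zero] at h0
  subst h0
  exact h (by simp [f.coeff_one])

theorem quad_eq_add_quad_Phi {d : ℕ} {f : PosRegFreeHol d} {A : Fin d → H →L[ℂ] H}
    (hA : WeaklyConvergent f A) {Z : H →L[ℂ] H} (hZ : 0 ≤ Z) (hZ' : 0 ≤ Z - Phi f A Z) (x : H) :
    quad Z x = quad (Z - Phi f A Z) x + ∑' α, ENNReal.ofReal (f.coeff α) *
      quad Z (ContinuousLinearMap.adjoint (wordOp A α) x) := by
  rw [← (quad_Phi hA hZ).2 x, ← quad_add hZ' (quad_Phi hA hZ).1, sub_add_cancel]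

/-- One step of inverting `id - Φ` on a pure element `Z`: if `Z - Φ(Z)` is the sum of
`A_γ X A_γ*` with the coefficients of `(1 - f)^{-r}`, then `Z` is the sum with the coefficients of
`(1 - f)^{-(r+1)}`. The sum is at least `Z - Φ^N(Z)` for each `N`, and its truncations to words of
length less than `N` are at most `Z`. -/
theorem tsum_resolvCoeff_succ_quad {d : ℕ} {f : PosRegFreeHol d} {A : Fin d → H →L[ℂ] H}
    (hA : WeaklyConvergent f A) {X Z : H →L[ℂ] H} (hZ : 0 ≤ Z)
    (hZ' : 0 ≤ Z - Phi f A Z)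
    (hpure : ∀ x, Tendsto (fun s => quad ((Phi f A)^[s] Z) x) atTop (𝓝 0)) {r : ℕ}
    (hr : ∀ x, ∑' γ, resolvCoeff f r γ * quad X (ContinuousLinearMap.adjoint (wordOp A γ) x) =
      quad (Z - Phi f A Z) x) (x : H) :
    ∑' γ, resolvCoeff f (r + 1) γ * quad X (ContinuousLinearMap.adjoint (wordOp A γ) x) =
      quad Z x := by
  have hword : ∀ (α β : FreeMonoid (Fin d)) x,
      ContinuousLinearMap.adjoint (wordOp A (α * β)) x =
        ContinuousLinearMap.adjoint (wordOp A β) (ContinuousLinearMap.adjoint (wordOp A α) x) :=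
    fun α β x => by rw [wordOp_mul, adjoint_mul_apply]
  -- The sum satisfies the same recursion as the quadratic form of `Z`.
  have hrec : ∀ x,
      ∑' γ, resolvCoeff f (r + 1) γ * quad X (ContinuousLinearMap.adjoint (wordOp A γ) x) =
      quad (Z - Phi f A Z) x + ∑' α, ENNReal.ofReal (f.coeff α) * ∑' γ, resolvCoeff f (r + 1) γ *
        quad X (ContinuousLinearMap.adjoint (wordOp A γ)
          (ContinuousLinearMap.adjoint (wordOp A α) x)) := by
    intro x
    rw [tsum_resolvCoeff_rec, hr]
    simp only [hword]
  apply le_antisymm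
  · -- Truncations to words of length less than `N` stay below `Z`, because every word in `f` is
    -- nonempty and so each step of the recursion uses up at least one letter.
    have htrunc : ∀ N x, ∑' γ, resolvCoeff f (r + 1) γ * ({γ | γ.length < N}.indicator
        (fun γ => quad X (ContinuousLinearMap.adjoint (wordOp A γ) x)) γ) ≤ quad Z x := by
      intro N
      induction N with
      | zero => intro x; simp
      | succ N ih =>
        intro x
        rw [tsum_resolvCoeff_rec, quad_eq_add_quad_Phi hA hZ hZ', ← hr]
        refine add_le_add (ENNReal.tsum_le_tsum fun γ => ?_) (ENNReal.tsum_le_tsum fun α => ?_)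
        · gcongr
          exact Set.indicator_le_self _ _ _
        · by_cases hα : ENNReal.ofReal (f.coeff α) = 0
          · simp [hα]
          have hα := one_le_length_of_coeff_ne_zero f hα
          gcongr
          refine le_trans (ENNReal.tsum_le_tsum fun β => ?_) (ih _)
          gcongr
          by_cases hβ : (α * β).length < N + 1
          · rw [Set.indicator_of_mem (show α * β ∈ {γ | γ.length < N + 1} from hβ),
              Set.indicator_of_mem]
            · rw [hword]
            · rw [FreeMonoid.length_mul] at hβ
              simp only [Set.mem_ofPred_eq]
              omega
          · rw [Set.indicator_of_notMem (show α * β ∉ {γ | γ.length < N + 1} from hβ)]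
            exact zero_le
    rw [ENNReal.tsum_eq_iSup_sum]
    refine iSup_le fun s => ?_
    refine le_trans ?_ (htrunc (s.sup FreeMonoid.length + 1) x)
    refine le_trans (Finset.sum_le_sum fun γ hγ => ?_) (ENNReal.sum_le_tsum s)
    rw [Set.indicator_of_mem]
    exact Nat.lt_succ_of_le (Finset.le_sup (f := FreeMonoid.length) hγ)
  · have hN : ∀ N x, quad Z x ≤ ∑' γ, resolvCoeff f (r + 1) γ *
        quad X (ContinuousLinearMap.adjoint (wordOp A γ) x) + quad ((Phi f A)^[N] Z) x := by
      intro N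
      induction N with
      | zero => intro x; exact le_add_self
      | succ N ih =>
        intro x
        rw [quad_eq_add_quad_Phi hA hZ hZ', hrec, quad_Phi_iterate_succ hA hZ, add_assoc,
          ← ENNReal.tsum_add]
        gcongr with α
        rw [← mul_add]
        gcongr
        exact ih _
    have hlim := (hpure x).const_add (∑' γ, resolvCoeff f (r + 1) γ *
        quad X (ContinuousLinearMap.adjoint (wordOp A γ) x))
    rw [add_zero] at hlim
    exact ge_of_tendsto' hlim fun N => hN N x

/-- Inversion of `(id - Φ)^m` on a pure positive operator, by induction on `m` with `Y` replaced by
`Y - Φ(Y)`. -/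
theorem tsum_resolvCoeff_quad_iterate {d : ℕ} {f : PosRegFreeHol d} {A : Fin d → H →L[ℂ] H}
    (hA : WeaklyConvergent f A)
    (hpure : ∀ x, Tendsto (fun s => quad ((Phi f A)^[s] 1) x) atTop (𝓝 0)) (m : ℕ)
    {Y : H →L[ℂ] H} (hY : ∀ q ≤ m, 0 ≤ (fun Y => Y - Phi f A Y)^[q] Y) (x : H) :
    ∑' γ, resolvCoeff f m γ * quad ((fun Y => Y - Phi f A Y)^[m] Y)
      (ContinuousLinearMap.adjoint (wordOp A γ) x) = quad Y x := by
  induction m generalizing Y x with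
  | zero => simp [tsum_resolvCoeff_zero, wordOp_one, adjoint_one_eq]
  | succ m ih =>
    have hY0 : 0 ≤ Y := hY 0 (Nat.zero_le _)
    refine tsum_resolvCoeff_succ_quad hA hY0 (hY 1 (by omega)) (fun x => ?_) (fun x => ?_) x
    · refine tendsto_of_tendsto_of_tendsto_of_le_of_le tendsto_const_nhds ?_
        (fun s => zero_le) (fun s => quad_Phi_iterate_le hA hY0 s x)
      have := ENNReal.Tendsto.const_mul (hpure x) (Or.inr (enorm_ne_top (x := Y)))
      rwa [mul_zero] at this
    · exact ih (fun q hq => hY (q + 1) (by omega)) x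

theorem defect_succ {k : ℕ} {n : Fin (k + 1) → ℕ} (f : ∀ i, PosRegFreeHol (n i))
    (T : ∀ i, Fin (n i) → H →L[ℂ] H) (p : Fin (k + 1) → ℕ) (X : H →L[ℂ] H) :
    defect f T p X = (fun Y => Y - Phi (f 0) (T 0) Y)^[p 0]
      (defect (fun i => f i.succ) (fun i => T i.succ) (fun i => p i.succ) X) := by
  rw [defect, List.ofFn_succ]
  rfl

/-- A pure tuple of a polydomain satisfies `∑_γ b_γ T_γ Δ^m(I) T_γ* = I`, so that its
noncommutative Poisson kernel is an isometry. The maps `id - Φ_i` are inverted one at a time. -/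
theorem tsum_quad_defect {k : ℕ} {n : Fin k → ℕ} (f : ∀ i, PosRegFreeHol (n i)) (m : Fin k → ℕ)
    (T : ∀ i, Fin (n i) → H →L[ℂ] H) (hT : InPolydomain f m T) (hpure : IsPure f T) (x : H) :
    ∑' γ : MultiWord n, (∏ i, resolvCoeff (f i) (m i) (γ i)) *
      quad (defect f T m 1) (ContinuousLinearMap.adjoint (multiWordOp T γ) x) = ‖x‖ₑ ^ 2 := by
  rw [isPure_iff_quad hT.convergent] at hpure
  obtain ⟨hcomm, hconv, hpos⟩ := hT
  induction k generalizing x with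
  | zero =>
    rw [tsum_eq_single 1 fun γ hγ => absurd (Subsingleton.elim γ 1) hγ, multiWordOp_one,
      adjoint_one_eq]
    simp [defect, quad_one]
  | succ k ih =>
    -- The defects of the tail, with some power of `id - Φ_0` applied, are defects of `T`.
    have htail : ∀ p : Fin k → ℕ, p ≤ (fun i => m i.succ) → ∀ q ≤ m 0,
        0 ≤ (fun Y => Y - Phi (f 0) (T 0) Y)^[q]
          (defect (fun i => f i.succ) (fun i => T i.succ) p 1) := by
      intro p hp q hq
      have := hpos (Fin.cons q p) (fun i => by
        refine Fin.cases ?_ (fun i => ?_) i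
        · exact hq
        · exact hp i)
      rwa [defect_succ] at this
    rw [← ih (fun i => f i.succ) (fun i => m i.succ) (fun i => T i.succ) (fun i => hpure i.succ) x
      (fun s t hst => hcomm _ _ fun h => hst (Fin.succ_injective _ h)) (fun i => hconv i.succ)
      (fun p hp => htail p hp 0 (Nat.zero_le _)),
      ← (Fin.consEquiv fun i => FreeMonoid (Fin (n i))).tsum_eq, ENNReal.tsum_prod',
      ENNReal.tsum_comm]
    refine tsum_congr fun γ => ?_
    rw [← tsum_resolvCoeff_quad_iterate (hconv 0) (hpure 0) (m 0)
      (fun q hq => htail _ le_rfl q hq), ← ENNReal.tsum_mul_left]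
    refine tsum_congr fun α => ?_
    -- The defect has `id - Φ_0` outermost, so `T_{0,α}` has to be moved to the innermost place.
    have hword : multiWordOp T (Fin.cons α γ : MultiWord n) =
        multiWordOp (fun i => T i.succ) γ * wordOp (T 0) α := by
      have hc : Commute (wordOp (T 0) α) (multiWordOp (fun i => T i.succ) γ) := by
        refine Commute.list_prod_right _ _ fun y hy => ?_
        obtain ⟨i, rfl⟩ := (List.mem_ofFn' _ _).1 hy
        exact commute_wordOp (hcomm _ _ (Fin.succ_ne_zero i).symm) _ _
      rw [← hc.eq, multiWordOp, List.ofFn_succ, List.prod_cons]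
      rfl
    change (∏ i, resolvCoeff (f i) (m i) ((Fin.cons α γ : MultiWord n) i)) *
      quad _ (ContinuousLinearMap.adjoint (multiWordOp T (Fin.cons α γ : MultiWord n)) x) = _
    rw [hword, adjoint_mul_apply, Fin.prod_univ_succ, defect_succ, mul_comm (resolvCoeff _ _ _),
      mul_assoc]
    rfl

end Reconstruction

/-! ### Tuples with an isometric Poisson kernel -/

section Kernel

theorem resolvCoeff_mono {d : ℕ} (f : PosRegFreeHol d) (α : FreeMonoid (Fin d)) :
    Monotone fun r => resolvCoeff f r α := by
  refine monotone_nat_of_le_succ fun r => ?_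
  have h : ∀ r, ∑' γ, resolvCoeff f r γ * Set.indicator {α} 1 γ = resolvCoeff f r α := fun r => by
    rw [tsum_eq_single α fun γ hγ => by simp [hγ]]
    simp
  simpa only [h] using tsum_resolvCoeff_le_succ f r (Set.indicator {α} 1)

/-- A sum over families, with product weights, is summed over the `i`-th component first. -/
theorem tsum_pi_prod_mul {ι : Type*} [Fintype ι] [DecidableEq ι] {M : ι → Type*} (i : ι)
    (g : ∀ t, M t → ℝ≥0∞) (F : (∀ t, M t) → ℝ≥0∞) :
    ∑' γ, (∏ t, g t (γ t)) * F γ = ∑' δ : ∀ t : {t // t ≠ i}, M t,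
      (∏ t : {t // t ≠ i}, g t (δ t)) * ∑' a, g i a * F ((Equiv.piSplitAt i M).symm (a, δ)) := by
  rw [← (Equiv.piSplitAt i M).symm.tsum_eq, ENNReal.tsum_prod', ENNReal.tsum_comm]
  refine tsum_congr fun δ => ?_
  rw [← ENNReal.tsum_mul_left]
  refine tsum_congr fun a => ?_
  rw [Fintype.prod_eq_mul_prod_subtype_ne _ i]
  have h1 : (Equiv.piSplitAt i M).symm (a, δ) i = a := by simp [Equiv.piSplitAt]
  have h2 : ∀ t : {t // t ≠ i}, (Equiv.piSplitAt i M).symm (a, δ) t = δ t := fun t => by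
    simp [Equiv.piSplitAt, t.2]
  simp only [h1, h2]
  ring

variable {k : ℕ} {n : Fin k → ℕ}

/-- The recursion `tsum_resolvCoeff_rec` in the `i`-th component. -/
theorem tsum_prod_resolvCoeff_rec (f : ∀ i, PosRegFreeHol (n i)) (r : Fin k → ℕ) (i : Fin k)
    {s : ℕ} (hs : r i = s + 1) (F : MultiWord n → ℝ≥0∞) :
    ∑' γ : MultiWord n, (∏ t, resolvCoeff (f t) (r t) (γ t)) * F γ =
      ∑' γ : MultiWord n, (∏ t, resolvCoeff (f t) (Function.update r i s t) (γ t)) * F γ +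
      ∑' α, ENNReal.ofReal ((f i).coeff α) * ∑' γ : MultiWord n,
        (∏ t, resolvCoeff (f t) (r t) (γ t)) * F (Pi.mulSingle i α * γ) := by
  have hmul : ∀ α β δ, Pi.mulSingle i α *
      (Equiv.piSplitAt i fun i => FreeMonoid (Fin (n i))).symm (β, δ) =
        (Equiv.piSplitAt i fun i => FreeMonoid (Fin (n i))).symm (α * β, δ) := by
    intro α β δ
    funext t
    by_cases ht : t = i
    · subst ht; simp [Equiv.piSplitAt]
    · simp [Equiv.piSplitAt, ht]
  simp only [tsum_pi_prod_mul i (fun t => resolvCoeff (f t) (r t)),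
    tsum_pi_prod_mul i (fun t => resolvCoeff (f t) (Function.update r i s t)), hmul,
    ← ENNReal.tsum_mul_left (a := ENNReal.ofReal _)]
  rw [ENNReal.tsum_comm, ← ENNReal.tsum_add]
  refine tsum_congr fun δ => ?_
  have hδ : ∏ t : {t // t ≠ i}, resolvCoeff (f t) (Function.update r i s t) (δ t) =
      ∏ t : {t // t ≠ i}, resolvCoeff (f t) (r t) (δ t) :=
    Finset.prod_congr rfl fun t _ => by rw [Function.update_of_ne t.2]
  rw [hδ, Function.update_self, hs, tsum_resolvCoeff_rec, mul_add]
  congr 1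
  rw [← ENNReal.tsum_mul_left]
  refine tsum_congr fun α => ?_
  rw [mul_left_comm]

variable {H : Type*} [NormedAddCommGroup H] [InnerProductSpace ℂ H]

theorem sub_nonneg_of_quad_le {X Y : H →L[ℂ] H} (hX : 0 ≤ X) (hY : 0 ≤ Y)
    (h : ∀ x, quad Y x ≤ quad X x) : 0 ≤ X - Y := by
  rw [ContinuousLinearMap.nonneg_iff_isPositive, ContinuousLinearMap.isPositive_iff_complex]
  intro x
  have hx : ⟪(X - Y) x, x⟫_ℂ = (((quad X x).toReal - (quad Y x).toReal : ℝ) : ℂ) := by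
    rw [sub_apply, inner_sub_left, inner_eq_quad hX, inner_eq_quad hY]
    push_cast
    rfl
  rw [hx]
  refine ⟨by simp, ?_⟩
  simpa using ENNReal.toReal_mono (quad_ne_top _ _) (h x)

variable [CompleteSpace H]

theorem tsum_quad_eq_quad_sub {d : ℕ} {f : PosRegFreeHol d} {A : Fin d → H →L[ℂ] H}
    {Z Z' : H →L[ℂ] H} (hZ : 0 ≤ Z) (hZ' : 0 ≤ Z')
    (h : ∀ x, quad Z x = quad Z' x + ∑' α, ENNReal.ofReal (f.coeff α) *
      quad Z (ContinuousLinearMap.adjoint (wordOp A α) x)) :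
    0 ≤ Z - Z' ∧ ∀ x, ∑' α, ENNReal.ofReal (f.coeff α) *
      quad Z (ContinuousLinearMap.adjoint (wordOp A α) x) = quad (Z - Z') x := by
  have h0 : 0 ≤ Z - Z' := sub_nonneg_of_quad_le hZ hZ' fun x => by rw [h x]; exact le_self_add
  refine ⟨h0, fun x => ?_⟩
  have h1 := quad_add h0 hZ' x
  rw [sub_add_cancel, h x, add_comm] at h1
  exact (ENNReal.add_left_inj (quad_ne_top Z' x)).1 h1

variable {E : Type*} [NormedAddCommGroup E] [InnerProductSpace ℂ E]

/-- The quadratic form `x ↦ ∑_γ b_γ^{(r)} ‖R T_γ* x‖²`, with the coefficients `b_γ^{(r)}` of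
`∏_i (1 - f_i)^{-r_i}`. -/
def kernelForm (f : ∀ i, PosRegFreeHol (n i)) (T : ∀ i, Fin (n i) → H →L[ℂ] H) (R : H →L[ℂ] E)
    (r : Fin k → ℕ) (x : H) : ℝ≥0∞ :=
  ∑' γ : MultiWord n, (∏ t, resolvCoeff (f t) (r t) (γ t)) *
    ‖R (ContinuousLinearMap.adjoint (multiWordOp T γ) x)‖ₑ ^ 2

theorem kernelForm_mono (f : ∀ i, PosRegFreeHol (n i)) (T : ∀ i, Fin (n i) → H →L[ℂ] H)
    (R : H →L[ℂ] E) {r p : Fin k → ℕ} (h : r ≤ p) (x : H) :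
    kernelForm f T R r x ≤ kernelForm f T R p x := by
  refine ENNReal.tsum_le_tsum fun γ => ?_
  gcongr with t
  exact resolvCoeff_mono _ _ (h t)

theorem kernelForm_rec {f : ∀ i, PosRegFreeHol (n i)} {T : ∀ i, Fin (n i) → H →L[ℂ] H}
    (hcomm : ∀ s t, s ≠ t → ∀ j l, Commute (T s j) (T t l)) (R : H →L[ℂ] E) {r : Fin k → ℕ}
    {i : Fin k} {s : ℕ} (hs : r i = s + 1) (x : H) :
    kernelForm f T R r x = kernelForm f T R (Function.update r i s) x +
      ∑' α, ENNReal.ofReal ((f i).coeff α) *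
        kernelForm f T R r (ContinuousLinearMap.adjoint (wordOp (T i) α) x) := by
  rw [kernelForm, tsum_prod_resolvCoeff_rec f r i hs]
  simp only [adjoint_multiWordOp_mul hcomm, multiWordOp_mulSingle]
  rfl

theorem exists_quad_eq_kernelForm [CompleteSpace E] {f : ∀ i, PosRegFreeHol (n i)}
    {T : ∀ i, Fin (n i) → H →L[ℂ] H} {R : H →L[ℂ] E} {m : Fin k → ℕ}
    (hR : ∀ x, kernelForm f T R m x = ‖x‖ₑ ^ 2) {r : Fin k → ℕ} (hr : r ≤ m) :
    ∃ Z : H →L[ℂ] H, 0 ≤ Z ∧ ∀ x, quad Z x = kernelForm f T R r x := by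
  have hterm : ∀ (γ : MultiWord n) x,
      ‖((√(∏ t, resolvCoeff (f t) (r t) (γ t)).toReal : ℂ) •
        (R ∘L ContinuousLinearMap.adjoint (multiWordOp T γ))) x‖ₑ ^ 2 =
      (∏ t, resolvCoeff (f t) (r t) (γ t)) *
        ‖R (ContinuousLinearMap.adjoint (multiWordOp T γ) x)‖ₑ ^ 2 := by
    intro γ x
    rw [smul_apply, enorm_smul, mul_pow, ContinuousLinearMap.comp_apply, enorm_sq_eq_ofReal,
      Complex.norm_real, Real.norm_eq_abs, sq_abs, Real.sq_sqrt ENNReal.toReal_nonneg,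
      ENNReal.ofReal_toReal]
    exact ENNReal.prod_ne_top fun t _ => resolvCoeff_ne_top _ _ _
  obtain ⟨Z, hZ, h⟩ := exists_quad_eq_tsum (fun γ : MultiWord n =>
      (√(∏ t, resolvCoeff (f t) (r t) (γ t)).toReal : ℂ) •
        (R ∘L ContinuousLinearMap.adjoint (multiWordOp T γ))) 1 (fun x => by
    simp only [hterm]
    rw [one_mul, ← enorm_sq_eq_ofReal, ← hR]
    exact kernelForm_mono f T R hr x)
  refine ⟨Z, hZ, fun x => ?_⟩
  rw [h]
  simp only [hterm]
  rfl

theorem weaklyConvergent_of_kernelForm [CompleteSpace E] {f : ∀ i, PosRegFreeHol (n i)}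
    {T : ∀ i, Fin (n i) → H →L[ℂ] H}
    (hcomm : ∀ s t, s ≠ t → ∀ j l, Commute (T s j) (T t l)) {R : H →L[ℂ] E} {m : Fin k → ℕ}
    (hm : ∀ i, 1 ≤ m i) (hR : ∀ x, kernelForm f T R m x = ‖x‖ₑ ^ 2) (i : Fin k) :
    WeaklyConvergent (f i) (T i) := by
  obtain ⟨s, hs⟩ := Nat.exists_eq_add_of_le' (hm i)
  obtain ⟨Z, hZ, hq⟩ := exists_quad_eq_kernelForm hR (r := Function.update m i s)
    (update_le_self_iff.2 (by omega))
  obtain ⟨h0, h⟩ := tsum_quad_eq_quad_sub (f := f i) (A := T i) zero_le_one hZ (fun x => by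
    simp only [quad_one, hq, ← hR]
    exact kernelForm_rec hcomm R hs x)
  exact weaklyConvergent_of_quad h0 h

/-- Applying `id - Φ_i` lowers the exponent of `(1 - f_i)^{-1}` by one. -/
theorem quad_sub_Phi_eq_kernelForm [CompleteSpace E] {f : ∀ i, PosRegFreeHol (n i)}
    {T : ∀ i, Fin (n i) → H →L[ℂ] H}
    (hcomm : ∀ s t, s ≠ t → ∀ j l, Commute (T s j) (T t l)) {R : H →L[ℂ] E} {m : Fin k → ℕ}
    (hR : ∀ x, kernelForm f T R m x = ‖x‖ₑ ^ 2) {r : Fin k → ℕ} (hr : r ≤ m) {i : Fin k} {s : ℕ}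
    (hs : r i = s + 1) {Z : H →L[ℂ] H} (hZ : 0 ≤ Z) (hq : ∀ x, quad Z x = kernelForm f T R r x) :
    0 ≤ Z - Phi (f i) (T i) Z ∧
      ∀ x, quad (Z - Phi (f i) (T i) Z) x = kernelForm f T R (Function.update r i s) x := by
  obtain ⟨Z', hZ', hq'⟩ := exists_quad_eq_kernelForm hR (r := Function.update r i s)
    ((update_le_self_iff.2 (by omega)).trans hr)
  obtain ⟨h0, h⟩ := tsum_quad_eq_quad_sub (f := f i) (A := T i) hZ hZ' (fun x => by
    simp only [hq, hq']
    exact kernelForm_rec hcomm R hs x)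
  rw [Phi_eq_of_quad hZ h0 h, sub_sub_cancel]
  exact ⟨hZ', hq'⟩

/-- Applying `(id - Φ_i)^q` lowers the exponent of `(1 - f_i)^{-1}` by `q`. -/
theorem quad_iterate_eq_kernelForm [CompleteSpace E] {f : ∀ i, PosRegFreeHol (n i)}
    {T : ∀ i, Fin (n i) → H →L[ℂ] H}
    (hcomm : ∀ s t, s ≠ t → ∀ j l, Commute (T s j) (T t l)) {R : H →L[ℂ] E} {m : Fin k → ℕ}
    (hR : ∀ x, kernelForm f T R m x = ‖x‖ₑ ^ 2) (q : ℕ) {r : Fin k → ℕ} (hr : r ≤ m) {i : Fin k}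
    (hq : q ≤ r i) {Z : H →L[ℂ] H} (hZ : 0 ≤ Z) (hZq : ∀ x, quad Z x = kernelForm f T R r x) :
    0 ≤ (fun Y => Y - Phi (f i) (T i) Y)^[q] Z ∧
      ∀ x, quad ((fun Y => Y - Phi (f i) (T i) Y)^[q] Z) x =
        kernelForm f T R (Function.update r i (r i - q)) x := by
  induction q with
  | zero => simpa using ⟨hZ, hZq⟩
  | succ q ih =>
    obtain ⟨h0, h⟩ := ih (by omega)
    rw [Function.iterate_succ_apply']
    have := quad_sub_Phi_eq_kernelForm hcomm hR
      ((update_le_self_iff.2 (by omega)).trans hr) (i := i) (s := r i - (q + 1))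
      (by rw [Function.update_self]; omega) h0 h
    simpa only [Function.update_idem] using this

/-- The defect of order `p` has the quadratic form with exponents `m - p`, hence is positive. -/
theorem defect_nonneg_of_kernelForm [CompleteSpace E] {f : ∀ i, PosRegFreeHol (n i)}
    {T : ∀ i, Fin (n i) → H →L[ℂ] H}
    (hcomm : ∀ s t, s ≠ t → ∀ j l, Commute (T s j) (T t l)) {R : H →L[ℂ] E} {m : Fin k → ℕ}
    (hR : ∀ x, kernelForm f T R m x = ‖x‖ₑ ^ 2) {p : Fin k → ℕ} (hp : p ≤ m) :
    0 ≤ defect f T p 1 := by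
  have key : ∀ l : List (Fin k), l.Nodup →
      0 ≤ (l.map fun i => (fun Y => Y - Phi (f i) (T i) Y)^[p i]).foldr (fun g Y => g Y)
        (1 : H →L[ℂ] H) ∧
      ∀ x, quad ((l.map fun i => (fun Y => Y - Phi (f i) (T i) Y)^[p i]).foldr (fun g Y => g Y)
        (1 : H →L[ℂ] H)) x =
          kernelForm f T R (fun i => m i - if i ∈ l then p i else 0) x := by
    intro l
    induction l with
    | nil =>
      intro _
      refine ⟨zero_le_one, fun x => ?_⟩
      simp [quad_one, ← hR]
    | cons i l ih =>
      intro hl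
      rw [List.nodup_cons] at hl
      obtain ⟨h0, h⟩ := ih hl.2
      have := quad_iterate_eq_kernelForm hcomm hR (p i) (fun _ => Nat.sub_le _ _) (i := i)
        (by simpa [hl.1] using hp i) h0 h
      have hw : (fun t => m t - if t ∈ i :: l then p t else 0) = Function.update
          (fun t => m t - if t ∈ l then p t else 0) i
            ((m i - if i ∈ l then p i else 0) - p i) := by
        funext t
        by_cases ht : t = i
        · subst ht; simp [hl.1]
        · simp [ht]
      rw [hw]
      exact this
  rw [defect, List.ofFn_eq_map]
  exact (key _ (List.nodup_finRange k)).1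

/-- `Φ_i^s(I)` is dominated by the part of `∑_γ b_γ ‖R T_γ* x‖²` over the words with `|γ_i| ≥ s`,
since `f_i` has no constant term. -/
theorem quad_Phi_iterate_le_tsum {f : ∀ i, PosRegFreeHol (n i)}
    {T : ∀ i, Fin (n i) → H →L[ℂ] H}
    (hcomm : ∀ s t, s ≠ t → ∀ j l, Commute (T s j) (T t l)) {R : H →L[ℂ] E} {m : Fin k → ℕ}
    (hm : ∀ i, 1 ≤ m i) (hR : ∀ x, kernelForm f T R m x = ‖x‖ₑ ^ 2)
    (hconv : ∀ i, WeaklyConvergent (f i) (T i)) (i : Fin k) (s : ℕ) (x : H) :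
    quad ((Phi (f i) (T i))^[s] 1) x ≤ ∑' γ : MultiWord n,
      (∏ t, resolvCoeff (f t) (m t) (γ t)) * {γ : MultiWord n | s ≤ (γ i).length}.indicator
        (fun γ => ‖R (ContinuousLinearMap.adjoint (multiWordOp T γ) x)‖ₑ ^ 2) γ := by
  induction s generalizing x with
  | zero =>
    rw [Function.iterate_zero_apply, quad_one, ← hR, kernelForm]
    simp
  | succ s ih =>
    obtain ⟨q, hq⟩ := Nat.exists_eq_add_of_le' (hm i)
    rw [quad_Phi_iterate_succ (hconv i) zero_le_one, tsum_prod_resolvCoeff_rec f m i hq]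
    refine le_add_left (ENNReal.tsum_le_tsum fun α => ?_)
    by_cases hα : ENNReal.ofReal ((f i).coeff α) = 0
    · simp [hα]
    have hα := one_le_length_of_coeff_ne_zero (f i) hα
    gcongr
    refine (ih _).trans (ENNReal.tsum_le_tsum fun γ => ?_)
    gcongr
    by_cases hγ : s ≤ (γ i).length
    · rw [Set.indicator_of_mem (show γ ∈ {γ : MultiWord n | s ≤ (γ i).length} from hγ),
        Set.indicator_of_mem, adjoint_multiWordOp_mul hcomm, multiWordOp_mulSingle]
      simp only [Set.mem_ofPred_eq, Pi.mul_apply, Pi.mulSingle_eq_same, FreeMonoid.length_mul]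
      omega
    · rw [Set.indicator_of_notMem (show γ ∉ {γ : MultiWord n | s ≤ (γ i).length} from hγ)]
      exact zero_le

theorem tendsto_tsum_indicator_le {ι : Type*} (ℓ : ι → ℕ) {w : ι → ℝ≥0∞} {g : ι → ℝ≥0∞}
    (h : ∑' i, w i * g i ≠ ⊤) :
    Tendsto (fun s : ℕ => ∑' i, w i * {i | s ≤ ℓ i}.indicator g i) atTop (𝓝 0) := by
  have hA := ENNReal.tendsto_tsum_compl_atTop_zero h
  rw [ENNReal.tendsto_nhds_zero] at hA ⊢
  intro ε hε
  obtain ⟨A, hA⟩ := (hA ε hε).exists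
  filter_upwards [eventually_gt_atTop (A.sup ℓ)] with s hs
  refine le_trans ?_ hA
  change _ ≤ ∑' i : {i | i ∉ A}, w i * g i
  rw [tsum_subtype {i | i ∉ A} fun i => w i * g i]
  refine ENNReal.tsum_le_tsum fun i => ?_
  by_cases hi : s ≤ ℓ i
  · have hiA : i ∉ A := fun h => absurd (Finset.le_sup (f := ℓ) h) (by omega)
    rw [Set.indicator_of_mem (show i ∈ {i | s ≤ ℓ i} from hi)]
    exact (Set.indicator_of_mem (show i ∈ {i | i ∉ A} from hiA) fun i => w i * g i).ge
  · rw [Set.indicator_of_notMem (show i ∉ {i | s ≤ ℓ i} from hi), mul_zero]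
    exact zero_le

/-- If the coordinates `√b_γ R T_γ*` define an isometry, then `T` is a pure element of the
polydomain. -/
theorem inPolydomain_and_isPure_of_kernelForm [CompleteSpace E] {f : ∀ i, PosRegFreeHol (n i)}
    {T : ∀ i, Fin (n i) → H →L[ℂ] H}
    (hcomm : ∀ s t, s ≠ t → ∀ j l, Commute (T s j) (T t l)) {R : H →L[ℂ] E} {m : Fin k → ℕ}
    (hm : ∀ i, 1 ≤ m i) (hR : ∀ x, kernelForm f T R m x = ‖x‖ₑ ^ 2) :
    InPolydomain f m T ∧ IsPure f T := by
  have hconv := weaklyConvergent_of_kernelForm hcomm hm hR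
  refine ⟨⟨hcomm, hconv, fun p hp => defect_nonneg_of_kernelForm hcomm hR hp⟩, ?_⟩
  rw [isPure_iff_quad hconv]
  intro i x
  refine tendsto_of_tendsto_of_tendsto_of_le_of_le tendsto_const_nhds
    (tendsto_tsum_indicator_le (fun γ : MultiWord n => (γ i).length) ?_) (fun s => zero_le)
    (fun s => quad_Phi_iterate_le_tsum hcomm hm hR hconv i s x)
  change kernelForm f T R m x ≠ ⊤
  rw [hR]
  exact ENNReal.pow_ne_top enorm_ne_top

end Kernel

/-! ### Hilbert space tensor products with subspaces of `ℓ²` -/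

section Tensor

variable {Ω : Type*} {E : Type*} [NormedAddCommGroup E] [InnerProductSpace ℂ E]

/-- The elementary tensor `x ⊗ y`, as the vector-valued sequence `γ ↦ x_γ y`. -/
def smulVec (x : lp (fun _ : Ω => ℂ) 2) (y : E) : lp (fun _ : Ω => E) 2 :=
  ⟨fun γ => x γ • y, memℓp_gen (by
    have hx : Summable fun γ => ‖x γ‖ ^ 2 := by
      simpa using (lp.memℓp x).summable (by norm_num)
    simpa [norm_smul, mul_pow] using hx.mul_right (‖y‖ ^ 2))⟩

theorem smulVec_apply (x : lp (fun _ : Ω => ℂ) 2) (y : E) (γ : Ω) : smulVec x y γ = x γ • y := rfl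

theorem inner_smulVec (x x' : lp (fun _ : Ω => ℂ) 2) (y y' : E) :
    ⟪smulVec x y, smulVec x' y'⟫_ℂ = ⟪x, x'⟫_ℂ * ⟪y, y'⟫_ℂ := by
  rw [lp.inner_eq_tsum, lp.inner_eq_tsum, ← tsum_mul_right]
  refine tsum_congr fun γ => ?_
  rw [smulVec_apply, smulVec_apply, inner_smul_left, inner_smul_right, ← mul_assoc]
  congr 1
  simp [mul_comm]

/-- The bilinear map `(x, y) ↦ x ⊗ y` into the vector-valued `ℓ²`. -/
def smulVecₗ : lp (fun _ : Ω => ℂ) 2 →ₗ[ℂ] E →ₗ[ℂ] lp (fun _ : Ω => E) 2 :=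
  LinearMap.mk₂ ℂ smulVec
    (fun x x' y => by ext γ; exact add_smul _ _ _)
    (fun c x y => by ext γ; exact mul_smul _ _ _)
    (fun x y y' => by ext γ; exact smul_add _ _ _)
    (fun c x y => by ext γ; exact smul_comm _ _ _)

theorem norm_smulVec (x : lp (fun _ : Ω => ℂ) 2) (y : E) : ‖smulVec x y‖ = ‖x‖ * ‖y‖ := by
  have h := inner_smulVec x x y y
  simp only [inner_self_eq_norm_sq_to_K] at h
  have h' : ‖smulVec x y‖ ^ 2 = (‖x‖ * ‖y‖) ^ 2 := by
    rw [mul_pow]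
    exact_mod_cast h
  exact (pow_left_inj₀ (norm_nonneg _) (by positivity) two_ne_zero).1 h'

/-- The bounded operator `x ↦ x ⊗ y`. -/
def smulVecRight (y : E) : lp (fun _ : Ω => ℂ) 2 →L[ℂ] lp (fun _ : Ω => E) 2 :=
  (smulVecₗ.flip y).mkContinuous ‖y‖ fun x => by
    rw [mul_comm]
    exact (norm_smulVec x y).le

theorem smulVecRight_apply (y : E) (x : lp (fun _ : Ω => ℂ) 2) :
    smulVecRight y x = smulVec x y := rfl

/-- The `γ`-th coordinate of a vector-valued sequence. -/
def coordCLM (γ : Ω) : lp (fun _ : Ω => E) 2 →L[ℂ] E :=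
  LinearMap.mkContinuous
    { toFun := fun F => F γ
      map_add' := fun _ _ => rfl
      map_smul' := fun _ _ => rfl } 1 fun F => by
    rw [one_mul]
    exact lp.norm_apply_le_norm (by norm_num) F γ

theorem inner_smulVec_single [DecidableEq Ω] (γ : Ω) (y : E) (F : lp (fun _ : Ω => E) 2) :
    ⟪smulVec (lp.single 2 γ 1) y, F⟫_ℂ = ⟪y, F γ⟫_ℂ := by
  have h : smulVec (lp.single 2 γ 1) y = lp.single 2 γ y := by
    ext δ
    rw [smulVec_apply]
    by_cases hδ : δ = γ
    · subst hδ; simp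
    · simp [hδ]
  rw [h, lp.inner_single_left]

theorem adjoint_smulVecRight_apply [CompleteSpace E] (y : E) (F : lp (fun _ : Ω => E) 2) (γ : Ω) :
    ContinuousLinearMap.adjoint (smulVecRight y) F γ = ⟪y, F γ⟫_ℂ := by
  classical
  rw [← inner_smulVec_single, ← smulVecRight_apply, ← ContinuousLinearMap.adjoint_inner_right,
    lp.inner_single_left]
  simp

variable {K : Type*} [NormedAddCommGroup K] [InnerProductSpace ℂ K]

/-- For a space `K` embedded isometrically in `ℓ²(Ω)`, the algebraic tensor product `K ⊗ E` embeds
isometrically in the `E`-valued `ℓ²`. -/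
def algTensorToLp (ι : K →ₗᵢ[ℂ] lp (fun _ : Ω => ℂ) 2) :
    K ⊗[ℂ] E →ₗᵢ[ℂ] lp (fun _ : Ω => E) 2 :=
  let L : K ⊗[ℂ] E →ₗ[ℂ] lp (fun _ : Ω => E) 2 := TensorProduct.lift (smulVecₗ.comp ι.toLinearMap)
  have hL : ∀ z z' : K ⊗[ℂ] E, ⟪L z, L z'⟫_ℂ = ⟪z, z'⟫_ℂ := fun z z' => by
    induction z using TensorProduct.induction_on with
    | zero => simp
    | add z₁ z₂ h₁ h₂ => rw [map_add, inner_add_left, inner_add_left, h₁, h₂]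
    | tmul x y =>
      induction z' using TensorProduct.induction_on with
      | zero => simp
      | add z₁ z₂ h₁ h₂ => rw [map_add, inner_add_right, inner_add_right, h₁, h₂]
      | tmul x' y' =>
        rw [TensorProduct.inner_tmul, TensorProduct.lift.tmul, TensorProduct.lift.tmul]
        refine (inner_smulVec _ _ _ _).trans ?_
        exact congrArg (· * _) (ι.inner_map_map x x')
  L.isometryOfInner hL

theorem hilbertTensor_induction {p : HilbertTensor K E → Prop} (closed : IsClosed {z | p z})
    (zero : p 0) (add : ∀ z z', p z → p z' → p (z + z'))
    (tmul : ∀ (x : K) (y : E), p ((x ⊗ₜ[ℂ] y : K ⊗[ℂ] E) : HilbertTensor K E))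
    (z : HilbertTensor K E) : p z := by
  induction z using UniformSpace.Completion.induction_on with
  | hp => exact closed
  | ih z =>
    induction z using TensorProduct.induction_on with
    | zero => exact zero
    | add z₁ z₂ h₁ h₂ =>
      rw [UniformSpace.Completion.coe_add]
      exact add _ _ h₁ h₂
    | tmul x y => exact tmul x y

variable [CompleteSpace E]

/-- For a space `K` embedded isometrically in `ℓ²(Ω)`, the Hilbert space tensor product `K ⊗ E`
embeds isometrically in the `E`-valued `ℓ²`. -/
def tensorToLp (ι : K →ₗᵢ[ℂ] lp (fun _ : Ω => ℂ) 2) :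
    HilbertTensor K E →ₗᵢ[ℂ] lp (fun _ : Ω => E) 2 where
  toLinearMap := (algTensorToLp (E := E) ι).toContinuousLinearMap.fromCompletion.toLinearMap
  norm_map' z := by
    induction z using UniformSpace.Completion.induction_on with
    | hp => exact isClosed_eq (by fun_prop) (by fun_prop)
    | ih z => simp

theorem tensorToLp_tmul (ι : K →ₗᵢ[ℂ] lp (fun _ : Ω => ℂ) 2) (x : K) (y : E) :
    tensorToLp ι ((x ⊗ₜ[ℂ] y : K ⊗[ℂ] E) : HilbertTensor K E) = smulVec (ι x) y := by
  change (algTensorToLp (E := E) ι).toContinuousLinearMap.fromCompletion _ = _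
  rw [ContinuousLinearMap.fromCompletion_apply_coe]
  exact TensorProduct.lift.tmul _ _

/-- If `B` is a weighted backward shift, then so is `B ⊗ I`. -/
theorem tensorToLp_ampliation (ι : K →ₗᵢ[ℂ] lp (fun _ : Ω => ℂ) 2) (B : K →L[ℂ] K)
    (σ : Ω → Ω) (w : Ω → ℂ) (hB : ∀ (x : K) γ, ι (B x) γ = w γ * ι x (σ γ))
    (z : HilbertTensor K E) (γ : Ω) :
    tensorToLp ι (ampliation E B z) γ = w γ • tensorToLp ι z (σ γ) := by
  induction z using hilbertTensor_induction with
  | closed =>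
    refine isClosed_eq ?_ ?_
    · exact (coordCLM γ).continuous.comp
        ((tensorToLp ι).continuous.comp (ampliation E B).continuous)
    · exact ((coordCLM (σ γ)).continuous.comp (tensorToLp ι).continuous).const_smul _
  | zero => simp
  | add z₁ z₂ h₁ h₂ =>
    rw [map_add, map_add, map_add, lp.coeFn_add, lp.coeFn_add, Pi.add_apply, Pi.add_apply, h₁, h₂,
      smul_add]
  | tmul x y =>
    rw [ampliation_tmul, tensorToLp_tmul, tensorToLp_tmul, smulVec_apply, smulVec_apply, hB,
      mul_smul]

/-- The image of `Mᗮ ⊗ E` consists of the sequences orthogonal to `M ⊗ E`. If `F` is such a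
sequence, its component `F₂` orthogonal to the image is orthogonal to all elementary tensors, since
`ℓ² = M ⊕ Mᗮ`, and so it vanishes. -/
theorem mem_range_tensorToLp_iff [CompleteSpace K] (ι : K →ₗᵢ[ℂ] lp (fun _ : Ω => ℂ) 2)
    (M : Submodule ℂ (lp (fun _ : Ω => ℂ) 2)) [M.HasOrthogonalProjection]
    (hι : LinearMap.range ι.toLinearMap = Mᗮ) (F : lp (fun _ : Ω => E) 2) :
    F ∈ LinearMap.range (tensorToLp (E := E) ι).toLinearMap ↔
      ∀ x ∈ M, ∀ y, ⟪smulVec x y, F⟫_ℂ = 0 := by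
  classical
  have himp : ∀ F ∈ LinearMap.range (tensorToLp (E := E) ι).toLinearMap,
      ∀ x ∈ M, ∀ y, ⟪smulVec x y, F⟫_ℂ = 0 := by
    rintro _ ⟨z, rfl⟩ x hx y
    change ⟪smulVec x y, tensorToLp ι z⟫_ℂ = 0
    induction z using hilbertTensor_induction with
    | closed => exact isClosed_eq (by fun_prop) (by fun_prop)
    | zero => simp
    | add z₁ z₂ h₁ h₂ => rw [map_add, inner_add_right, h₁, h₂, add_zero]
    | tmul x' y' =>
      have hx' : ι x' ∈ Mᗮ := hι ▸ LinearMap.mem_range_self ι.toLinearMap x'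
      rw [tensorToLp_tmul, inner_smulVec, (Submodule.mem_orthogonal _ _).1 hx' x hx, zero_mul]
  refine ⟨himp F, fun hF => ?_⟩
  have hclosed : IsClosed (LinearMap.range (tensorToLp (E := E) ι).toLinearMap :
      Set (lp (fun _ : Ω => E) 2)) :=
    (tensorToLp (E := E) ι).isometry.isClosedEmbedding.isClosed_range
  have := hclosed.completeSpace_coe
  obtain ⟨F₁, hF₁, F₂, hF₂, rfl⟩ :=
    (LinearMap.range (tensorToLp (E := E) ι).toLinearMap).exists_add_mem_mem_orthogonal F
  have h₂ : ∀ x y, ⟪smulVec x y, F₂⟫_ℂ = 0 := by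
    intro x y
    obtain ⟨x₁, hx₁, x₂, hx₂, rfl⟩ := M.exists_add_mem_mem_orthogonal x
    rw [← hι] at hx₂
    obtain ⟨x₂, rfl⟩ := hx₂
    rw [← smulVecRight_apply, map_add, inner_add_left, smulVecRight_apply, smulVecRight_apply]
    have ha : ⟪smulVec x₁ y, F₂⟫_ℂ = 0 := by
      have := hF x₁ hx₁ y
      rwa [inner_add_right, himp F₁ hF₁ x₁ hx₁ y, zero_add] at this
    have hb : ⟪smulVec (ι x₂) y, F₂⟫_ℂ = 0 :=
      (Submodule.mem_orthogonal _ _).1 hF₂ _ ⟨_, tensorToLp_tmul ι x₂ y⟩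
    rw [ha, zero_add]
    exact hb
  have h0 : F₂ = 0 := by
    ext γ
    refine ext_inner_left ℂ fun y => ?_
    rw [← inner_smulVec_single, h₂]
    simp
  rw [h0, add_zero]
  exact hF₁

end Tensor

/-! ### The universal model -/

section UniversalModel

variable {k : ℕ} {n : Fin k → ℕ}

/-- Induction on the number of letters of `(δ_1, …, δ_k)`. -/
theorem multiWord_induction (p : MultiWord n → Prop) (one : p 1)
    (prep : ∀ i j γ, p γ → p (prepend i j γ)) (δ : MultiWord n) : p δ := by
  refine pi_mulSingle_mul_induction p one (fun i α γ hγ => ?_) δ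
  induction α using FreeMonoid.inductionOn' with
  | one => simpa using! hγ
  | of_mul j α ih =>
    rw [Pi.mulSingle_mul, mul_assoc, ← prepend_eq_mul]
    exact prep i j _ ih

theorem creationWeight_ne_zero {d : ℕ} (f : PosRegFreeHol d) (m : ℕ) (j : Fin d)
    (α : FreeMonoid (Fin d)) : creationWeight f m j α ≠ 0 :=
  (div_pos (Real.sqrt_pos.2 (bCoeff_pos f m _)) (Real.sqrt_pos.2 (bCoeff_pos f m _))).ne'

variable (f : ∀ i, PosRegFreeHol (n i)) (m : Fin k → ℕ)

/-- `√b_γ` for a word `γ = (γ_1, …, γ_k)`, where `b_γ = ∏ b_{i,γ_i}`. -/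
def sqrtCoeff (γ : MultiWord n) : ℝ := ∏ i, √(bCoeff (f i) (m i) (γ i))

theorem sqrtCoeff_one : sqrtCoeff f m 1 = 1 := by simp [sqrtCoeff, bCoeff_one]

theorem creationWeight_mul_sqrtCoeff (i : Fin k) (j : Fin (n i)) (γ : MultiWord n) :
    creationWeight (f i) (m i) j (γ i) * sqrtCoeff f m (prepend i j γ) = sqrtCoeff f m γ := by
  have h : ∀ t ∈ ({i}ᶜ : Finset (Fin k)), √(bCoeff (f t) (m t) (prepend i j γ t)) =
      √(bCoeff (f t) (m t) (γ t)) := fun t ht => by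
    rw [prepend, Function.update_of_ne (by simpa using ht)]
  rw [sqrtCoeff, sqrtCoeff, Fintype.prod_eq_mul_prod_compl i, Fintype.prod_eq_mul_prod_compl i,
    Finset.prod_congr rfl h, ← mul_assoc, prepend, Function.update_self, creationWeight,
    div_mul_cancel₀ _ (Real.sqrt_pos.2 (bCoeff_pos _ _ _)).ne']

theorem enorm_sqrtCoeff_sq (hm : ∀ i, 1 ≤ m i) (γ : MultiWord n) :
    ‖(sqrtCoeff f m γ : ℂ)‖ₑ ^ 2 = ∏ t, resolvCoeff (f t) (m t) (γ t) := by
  rw [enorm_sq_eq_ofReal, Complex.norm_real, Real.norm_eq_abs, sq_abs, sqrtCoeff,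
    ← Finset.prod_pow, ENNReal.ofReal_prod_of_nonneg fun _ _ => by positivity]
  refine Finset.prod_congr rfl fun t _ => ?_
  obtain ⟨s, hs⟩ := Nat.exists_eq_add_of_le' (hm t)
  rw [Real.sq_sqrt (bCoeff_nonneg _ _ _), hs, resolvCoeff]

theorem adjoint_W_apply (i : Fin k) (j : Fin (n i)) (x : Fock n) (γ : MultiWord n) :
    ContinuousLinearMap.adjoint (W f m i j) x γ =
      (creationWeight (f i) (m i) j (γ i) : ℂ) * x (prepend i j γ) := by
  rw [W, weightedShift, ContinuousLinearMap.adjoint_adjoint, backShift_apply]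

theorem prepend_apply_of_ne {s t : Fin k} (h : t ≠ s) (j : Fin (n s)) (γ : MultiWord n) :
    prepend s j γ t = γ t := Function.update_of_ne h _ _

theorem prepend_comm {s t : Fin k} (h : s ≠ t) (j : Fin (n s)) (l : Fin (n t)) (γ : MultiWord n) :
    prepend s j (prepend t l γ) = prepend t l (prepend s j γ) := by
  rw [prepend, prepend_apply_of_ne h, prepend, prepend, prepend_apply_of_ne h.symm, prepend,
    Function.update_comm h]

theorem commute_W (s t : Fin k) (h : s ≠ t) (j : Fin (n s)) (l : Fin (n t)) :
    Commute (W f m s j) (W f m t l) := by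
  apply (ContinuousLinearMap.adjoint (𝕜 := ℂ) (E := Fock n) (F := Fock n)).injective
  ext x γ
  rw [adjoint_mul_apply, adjoint_mul_apply]
  simp only [adjoint_W_apply, prepend_apply_of_ne h, prepend_apply_of_ne h.symm,
    prepend_comm h]
  ring

theorem exists_multiWordOp_W_basisVec_one (γ : MultiWord n) :
    ∃ c : ℂ, basisVec γ = c • multiWordOp (W f m) γ (basisVec 1) := by
  induction γ using multiWord_induction with
  | one => exact ⟨1, by simp [multiWordOp_one]⟩
  | prep i j γ ih =>
    obtain ⟨c, hc⟩ := ih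
    have hw : (creationWeight (f i) (m i) j (γ i) : ℂ) ≠ 0 :=
      Complex.ofReal_ne_zero.2 (creationWeight_ne_zero _ _ _ _)
    refine ⟨(creationWeight (f i) (m i) j (γ i) : ℂ)⁻¹ * c, ?_⟩
    rw [multiWordOp_prepend (commute_W f m), mul_apply_eq_comp, mul_smul, ← map_smul, ← hc,
      W_single]
    exact (inv_smul_smul₀ hw _).symm

variable (Q : Set (NCPoly n))

theorem evalPoly_W_basisVec_mem_MQ {q : NCPoly n} (hq : q ∈ Q) (γ : MultiWord n) :
    evalPoly (W f m) q (basisVec γ) ∈ MQ f m Q := by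
  obtain ⟨c, hc⟩ := exists_multiWordOp_W_basisVec_one f m γ
  rw [hc, map_smul]
  refine Submodule.smul_mem _ _ (Submodule.le_topologicalClosure _ (Submodule.subset_span ?_))
  exact ⟨1, γ, q, hq, by simp [multiWordOp_one]⟩

theorem MQ_le {P : Submodule ℂ (Fock n)} (hP : IsClosed (P : Set (Fock n)))
    (h : ∀ α β : MultiWord n, ∀ q ∈ Q, multiWordOp (W f m) α (evalPoly (W f m) q
      (multiWordOp (W f m) β (basisVec 1))) ∈ P) : MQ f m Q ≤ P := by
  refine Submodule.topologicalClosure_minimal _ (Submodule.span_le.2 ?_) hP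
  rintro _ ⟨α, β, q, hq, rfl⟩
  exact h α β q hq

theorem W_mem_MQ (i : Fin k) (j : Fin (n i)) {x : Fock n} (hx : x ∈ MQ f m Q) :
    W f m i j x ∈ MQ f m Q := by
  have h : MQ f m Q ≤ (MQ f m Q).comap (W f m i j).toLinearMap := by
    refine MQ_le f m Q ?_ fun α β q hq => ?_
    · exact (Submodule.isClosed_topologicalClosure _).preimage (W f m i j).continuous
    · refine Submodule.le_topologicalClosure _ (Submodule.subset_span ⟨prepend i j α, β, q, hq, ?_⟩)
      rw [multiWordOp_prepend (commute_W f m)]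
      rfl
  exact h hx

/-- As `M_Q` is invariant under `W_{i,j}`, the adjoint of `S_{i,j}` is the restriction of
`W_{i,j}*`. -/
theorem adjoint_S_apply (i : Fin k) (j : Fin (n i)) (x : NQ f m Q) (γ : MultiWord n) :
    (ContinuousLinearMap.adjoint (S f m Q i j) x : Fock n) γ =
      (creationWeight (f i) (m i) j (γ i) : ℂ) * (x : Fock n) (prepend i j γ) := by
  have hmem : ContinuousLinearMap.adjoint (W f m i j) (x : Fock n) ∈ NQ f m Q := by
    rw [Submodule.mem_orthogonal]
    intro u hu
    rw [ContinuousLinearMap.adjoint_inner_right]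
    exact (Submodule.mem_orthogonal _ _).1 x.2 _ (W_mem_MQ f m Q i j hu)
  have h : ContinuousLinearMap.adjoint (S f m Q i j) x = ⟨_, hmem⟩ := by
    refine ext_inner_left ℂ fun v => ?_
    have h₁ : ⟪S f m Q i j v, x⟫_ℂ = ⟪W f m i j (v : Fock n), (x : Fock n)⟫_ℂ :=
      Submodule.inner_orthogonalProjectionOnto_eq_of_mem_right x (W f m i j (v : Fock n))
    rw [ContinuousLinearMap.adjoint_inner_right, h₁, ← ContinuousLinearMap.adjoint_inner_right]
    exact (Submodule.coe_inner _ v ⟨_, hmem⟩).symm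
  rw [h, adjoint_W_apply]

end UniversalModel

/-! ### Models as maps into the vector-valued Fock space -/

section ModelMap

variable {k : ℕ} {n : Fin k → ℕ} {H : Type*} [NormedAddCommGroup H] [InnerProductSpace ℂ H]

theorem intertwine_multiWordOp {K : Type*} [NormedAddCommGroup K] [InnerProductSpace ℂ K]
    {A : ∀ i, Fin (n i) → K →L[ℂ] K} {B : ∀ i, Fin (n i) → H →L[ℂ] H} {Y : K →L[ℂ] H}
    (h : ∀ i j, Y ∘L A i j = B i j ∘L Y) (α : MultiWord n) :
    Y ∘L multiWordOp A α = multiWordOp B α ∘L Y := by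
  have hw : ∀ i, Y ∘L wordOp (A i) (α i) = wordOp (B i) (α i) ∘L Y := by
    intro i
    induction α i using FreeMonoid.inductionOn' with
    | one => rw [wordOp_one, wordOp_one]; rfl
    | of_mul j α ih =>
      rw [wordOp_mul, wordOp_mul, wordOp_of, wordOp_of, ContinuousLinearMap.mul_def,
        ContinuousLinearMap.mul_def, ← ContinuousLinearMap.comp_assoc, h,
        ContinuousLinearMap.comp_assoc, ih, ContinuousLinearMap.comp_assoc]
  have hl : ∀ l : List (Fin k), Y ∘L (l.map fun i => wordOp (A i) (α i)).prod =
      (l.map fun i => wordOp (B i) (α i)).prod ∘L Y := by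
    intro l
    induction l with
    | nil => rfl
    | cons i l ih =>
      rw [List.map_cons, List.map_cons, List.prod_cons, List.prod_cons,
        ContinuousLinearMap.mul_def, ContinuousLinearMap.mul_def,
        ← ContinuousLinearMap.comp_assoc, hw, ContinuousLinearMap.comp_assoc, ih,
        ContinuousLinearMap.comp_assoc]
  rw [multiWordOp, multiWordOp, List.ofFn_eq_map, List.ofFn_eq_map, hl]

theorem intertwine_evalPoly {K : Type*} [NormedAddCommGroup K] [InnerProductSpace ℂ K]
    {A : ∀ i, Fin (n i) → K →L[ℂ] K} {B : ∀ i, Fin (n i) → H →L[ℂ] H} {Y : K →L[ℂ] H}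
    (h : ∀ i j, Y ∘L A i j = B i j ∘L Y) (q : NCPoly n) :
    Y ∘L evalPoly A q = evalPoly B q ∘L Y := by
  simp only [evalPoly, Finsupp.sum, ContinuousLinearMap.comp_finsetSum,
    ContinuousLinearMap.finsetSum_comp, ContinuousLinearMap.comp_smul,
    ContinuousLinearMap.smul_comp, intertwine_multiWordOp h]

variable [CompleteSpace H] {E : Type*} [NormedAddCommGroup E] [InnerProductSpace ℂ E]
  {f : ∀ i, PosRegFreeHol (n i)} {m : Fin k → ℕ} {T : ∀ i, Fin (n i) → H →L[ℂ] H}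

/-- `V T_{i,j}* = (W_{i,j}* ⊗ I) V`, where `W_{i,j}* ⊗ I` acts as a weighted backward shift on
`E`-valued sequences. -/
def IntertwinesShift (f : ∀ i, PosRegFreeHol (n i)) (m : Fin k → ℕ)
    (T : ∀ i, Fin (n i) → H →L[ℂ] H) (V : H →ₗᵢ[ℂ] lp (fun _ : MultiWord n => E) 2) : Prop :=
  ∀ i j h γ, V (ContinuousLinearMap.adjoint (T i j) h) γ =
    (creationWeight (f i) (m i) j (γ i) : ℂ) • V h (prepend i j γ)

/-- A model over `E` amounts to an isometry `V` of `H` into the `E`-valued `ℓ²`-space that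
intertwines `T_{i,j}*` with `W_{i,j}* ⊗ I` and whose range is orthogonal to `M_Q ⊗ E`. -/
theorem hasModel_iff [CompleteSpace E] (Q : Set (NCPoly n)) :
    HasModel f m Q T E ↔ ∃ V : H →ₗᵢ[ℂ] lp (fun _ : MultiWord n => E) 2,
      IntertwinesShift f m T V ∧ ∀ x ∈ MQ f m Q, ∀ y h, ⟪smulVec x y, V h⟫_ℂ = 0 := by
  have : CompleteSpace (MQ f m Q) :=
    (Submodule.isClosed_topologicalClosure _).completeSpace_coe
  let ι : NQ f m Q →ₗᵢ[ℂ] Fock n := (NQ f m Q).subtypeₗᵢ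
  have hι : LinearMap.range ι.toLinearMap = (MQ f m Q)ᗮ := Submodule.range_subtype _
  have hamp := fun i j => tensorToLp_ampliation (E := E) ι
    (ContinuousLinearMap.adjoint (S f m Q i j)) (prepend i j)
    (fun γ => (creationWeight (f i) (m i) j (γ i) : ℂ)) (adjoint_S_apply f m Q i j)
  constructor
  · rintro ⟨G, -, hG, U, hU⟩
    refine ⟨(tensorToLp ι).comp (G.subtypeₗᵢ.comp U.toLinearIsometry), ?_, ?_⟩
    · intro i j h γ
      change tensorToLp ι (U _ : HilbertTensor (NQ f m Q) E) γ = _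
      rw [hU, LinearIsometryEquiv.apply_symm_apply]
      exact hamp i j _ γ
    · intro x hx y h
      exact (mem_range_tensorToLp_iff ι (MQ f m Q) hι _).1 ⟨_, rfl⟩ x hx y
  · rintro ⟨V, hV, hQ⟩
    have hmem := fun h => (mem_range_tensorToLp_iff ι (MQ f m Q) hι (V h)).2 fun x hx y => hQ x hx y h
    let J := tensorToLp (E := E) ι
    let V' : H →ₗᵢ[ℂ] HilbertTensor (NQ f m Q) E := J.equivRange.symm.toLinearIsometry.comp
      { toLinearMap := V.toLinearMap.codRestrict _ hmem
        norm_map' := fun h => V.norm_map h }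
    have hV' : ∀ h, J (V' h) = V h := fun h =>
      congrArg Subtype.val (J.equivRange.apply_symm_apply ⟨V h, hmem h⟩)
    have hint : ∀ i j h, V' (ContinuousLinearMap.adjoint (T i j) h) =
        ampliation E (ContinuousLinearMap.adjoint (S f m Q i j)) (V' h) := by
      intro i j h
      apply J.injective
      ext γ
      rw [hV', hV, hamp i j, hV']
    refine ⟨LinearMap.range V'.toLinearMap, V'.isometry.isClosedEmbedding.isClosed_range, ?_,
      V'.equivRange, ?_⟩
    · rintro i j _ ⟨h, rfl⟩
      exact ⟨_, hint i j h⟩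
    · intro i j h
      rw [LinearIsometryEquiv.eq_symm_apply]
      exact Subtype.ext (hint i j h)

/-- The backward shifts commute for different first indices, and `V` is injective. -/
theorem commute_of_intertwinesShift {V : H →ₗᵢ[ℂ] lp (fun _ : MultiWord n => E) 2}
    (hV : IntertwinesShift f m T V) (s t : Fin k) (h : s ≠ t) (j : Fin (n s)) (l : Fin (n t)) :
    Commute (T s j) (T t l) := by
  apply (ContinuousLinearMap.adjoint (𝕜 := ℂ) (E := H) (F := H)).injective
  ext x
  apply V.injective
  ext γ
  rw [adjoint_mul_apply, adjoint_mul_apply]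
  simp only [hV _ _ _ _, prepend_apply_of_ne h, prepend_apply_of_ne h.symm, prepend_comm h]
  rw [smul_comm]

/-- All coordinates of `V` are determined by the coordinate at the empty word. -/
theorem apply_eq_of_intertwinesShift {V : H →ₗᵢ[ℂ] lp (fun _ : MultiWord n => E) 2}
    (hV : IntertwinesShift f m T V) (γ : MultiWord n) (h : H) :
    V h γ = (sqrtCoeff f m γ : ℂ) •
      V (ContinuousLinearMap.adjoint (multiWordOp T γ) h) 1 := by
  -- Multiplying by the nonzero weight turns the next coordinate into one of `V T_{i,j}* h`.
  induction γ using multiWord_induction generalizing h with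
  | one => simp [sqrtCoeff_one, multiWordOp_one, adjoint_one_eq]
  | prep i j γ ih =>
    have hw : (creationWeight (f i) (m i) j (γ i) : ℂ) ≠ 0 :=
      Complex.ofReal_ne_zero.2 (creationWeight_ne_zero _ _ _ _)
    apply smul_right_injective E hw
    change _ • _ = _ • _
    rw [← hV, ih, multiWordOp_prepend (commute_of_intertwinesShift hV), adjoint_mul_apply,
      smul_smul, ← Complex.ofReal_mul, creationWeight_mul_sqrtCoeff]

theorem kernelForm_of_intertwinesShift {V : H →ₗᵢ[ℂ] lp (fun _ : MultiWord n => E) 2}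
    (hm : ∀ i, 1 ≤ m i) (hV : IntertwinesShift f m T V) (x : H) :
    kernelForm f T (coordCLM 1 ∘L V.toContinuousLinearMap) m x = ‖x‖ₑ ^ 2 := by
  rw [← V.enorm_map, lp_enorm_sq, kernelForm]
  refine tsum_congr fun γ => ?_
  rw [apply_eq_of_intertwinesShift hV γ x, enorm_smul, mul_pow, enorm_sqrtCoeff_sq f m hm]
  rfl

/-- The noncommutative Poisson kernel `h ↦ (√b_γ R T_γ* h)_γ`. -/
theorem exists_intertwinesShift (hm : ∀ i, 1 ≤ m i)
    (hcomm : ∀ s t, s ≠ t → ∀ j l, Commute (T s j) (T t l)) {R : H →L[ℂ] E}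
    (hR : ∀ x, kernelForm f T R m x = ‖x‖ₑ ^ 2) :
    ∃ V : H →ₗᵢ[ℂ] lp (fun _ : MultiWord n => E) 2, IntertwinesShift f m T V := by
  let C : MultiWord n → H →L[ℂ] E := fun γ =>
    (sqrtCoeff f m γ : ℂ) • (R ∘L ContinuousLinearMap.adjoint (multiWordOp T γ))
  have hC : ∀ x, ∑' γ, ‖C γ x‖ₑ ^ 2 = ‖x‖ₑ ^ 2 := fun x => by
    rw [← hR, kernelForm]
    refine tsum_congr fun γ => ?_
    rw [← enorm_sqrtCoeff_sq f m hm, ← mul_pow, ← enorm_smul]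
    rfl
  have hC' : ∀ x, ∑' γ, ‖C γ x‖ₑ ^ 2 ≤ ENNReal.ofReal (1 * ‖x‖ ^ 2) := fun x => by
    rw [hC, one_mul, enorm_sq_eq_ofReal]
  refine ⟨⟨(colOp C 1 hC').toLinearMap, fun x => ?_⟩, fun i j h γ => ?_⟩
  · have h : ‖colOp C 1 hC' x‖ₑ ^ 2 = ‖x‖ₑ ^ 2 := by
      rw [lp_enorm_sq]
      exact hC x
    rw [enorm_sq_eq_ofReal, enorm_sq_eq_ofReal,
      ENNReal.ofReal_eq_ofReal_iff (by positivity) (by positivity)] at h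
    exact (pow_left_inj₀ (norm_nonneg _) (norm_nonneg _) two_ne_zero).1 h
  · change C γ _ = _ • C (prepend i j γ) h
    simp only [C, smul_apply, ContinuousLinearMap.comp_apply]
    rw [smul_smul, ← Complex.ofReal_mul, creationWeight_mul_sqrtCoeff, multiWordOp_prepend hcomm,
      adjoint_mul_apply]

variable [CompleteSpace E]

/-- `Y = V* (· ⊗ y)` satisfies `Y W_{i,j} = T_{i,j} Y`. -/
theorem intertwine_of_intertwinesShift {V : H →ₗᵢ[ℂ] lp (fun _ : MultiWord n => E) 2}
    (hV : IntertwinesShift f m T V) (y : E) (i : Fin k) (j : Fin (n i)) :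
    (ContinuousLinearMap.adjoint V.toContinuousLinearMap ∘L smulVecRight y) ∘L W f m i j =
      T i j ∘L (ContinuousLinearMap.adjoint V.toContinuousLinearMap ∘L smulVecRight y) := by
  have hs : ∀ h, ContinuousLinearMap.adjoint (W f m i j)
      (ContinuousLinearMap.adjoint (smulVecRight y) (V h)) =
      ContinuousLinearMap.adjoint (smulVecRight y)
        (V (ContinuousLinearMap.adjoint (T i j) h)) := by
    intro h
    ext γ
    rw [adjoint_W_apply, adjoint_smulVecRight_apply, adjoint_smulVecRight_apply, hV,
      inner_smul_right]
  ext x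
  refine ext_inner_right ℂ fun h => ?_
  simp only [ContinuousLinearMap.comp_apply]
  rw [ContinuousLinearMap.adjoint_inner_left, ← ContinuousLinearMap.adjoint_inner_right,
    ← ContinuousLinearMap.adjoint_inner_right, ← ContinuousLinearMap.adjoint_inner_right,
    ContinuousLinearMap.adjoint_inner_left, ← ContinuousLinearMap.adjoint_inner_right (smulVecRight y)]
  exact congrArg _ (hs h)

/-- With `Y = V* (· ⊗ y)`, `⟪y, (V q(T)* h)_γ⟫ = ⟪q(T) Y e_γ, h⟫ = ⟪q(W) e_γ ⊗ y, V h⟫ = 0`, since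
`q(W) e_γ` is a multiple of `q(W) W_γ e_1` and so lies in `M_Q`. -/
theorem evalPoly_eq_zero_of_model {Q : Set (NCPoly n)}
    {V : H →ₗᵢ[ℂ] lp (fun _ : MultiWord n => E) 2} (hV : IntertwinesShift f m T V)
    (hQ : ∀ x ∈ MQ f m Q, ∀ y h, ⟪smulVec x y, V h⟫_ℂ = 0) {q : NCPoly n} (hq : q ∈ Q) :
    evalPoly T q = 0 := by
  classical
  apply (ContinuousLinearMap.adjoint (𝕜 := ℂ) (E := H) (F := H)).injective
  ext h
  apply V.injective
  ext γ
  refine ext_inner_left ℂ fun y => ?_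
  rw [map_zero, zero_apply, map_zero, ← inner_smulVec_single]
  have h1 := congrArg (fun A => ⟪A (basisVec γ), h⟫_ℂ)
    (intertwine_evalPoly (intertwine_of_intertwinesShift hV y) q)
  simp only [ContinuousLinearMap.comp_apply] at h1
  rw [ContinuousLinearMap.adjoint_inner_left,
    ← ContinuousLinearMap.adjoint_inner_right (evalPoly T q),
    ContinuousLinearMap.adjoint_inner_left] at h1
  have h2 := hQ _ (evalPoly_W_basisVec_mem_MQ f m Q hq γ) y h
  have h3 : ⟪smulVec (lp.single 2 γ 1) y,
      V (ContinuousLinearMap.adjoint (evalPoly T q) h)⟫_ℂ = 0 := by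
    refine Eq.trans ?_ (h1.symm.trans h2)
    unfold basisVec
    congr!
  rw [h3]
  simp

/-- `Y = V* (· ⊗ y)` maps `W_α q(W) W_β e_1` to `T_α q(T) T_β Y e_1 = 0`. -/
theorem inner_smulVec_eq_zero_of_mem_MQ {Q : Set (NCPoly n)}
    {V : H →ₗᵢ[ℂ] lp (fun _ : MultiWord n => E) 2} (hV : IntertwinesShift f m T V)
    (hQ : ∀ q ∈ Q, evalPoly T q = 0) {x : Fock n} (hx : x ∈ MQ f m Q) (y : E) (h : H) :
    ⟪smulVec x y, V h⟫_ℂ = 0 := by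
  have hY := intertwine_of_intertwinesShift hV y
  set Y := ContinuousLinearMap.adjoint V.toContinuousLinearMap ∘L smulVecRight y with hYdef
  have hle : MQ f m Q ≤ LinearMap.ker Y.toLinearMap := by
    refine MQ_le f m Q Y.isClosed_ker fun α β q hq => ?_
    rw [LinearMap.mem_ker]
    have h1 := DFunLike.congr_fun (intertwine_multiWordOp hY α)
      (evalPoly (W f m) q (multiWordOp (W f m) β (basisVec 1)))
    have h2 := DFunLike.congr_fun (intertwine_evalPoly hY q)
      (multiWordOp (W f m) β (basisVec 1))
    simp only [ContinuousLinearMap.comp_apply Y, ContinuousLinearMap.comp_apply _ Y] at h1 h2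
    rw [hQ q hq, zero_apply] at h2
    rw [h2, map_zero] at h1
    exact h1
  have hx' : Y x = 0 := hle hx
  have h0 : ⟪Y x, h⟫_ℂ = 0 := by rw [hx', inner_zero_left]
  rw [hYdef, ContinuousLinearMap.comp_apply, ContinuousLinearMap.adjoint_inner_left] at h0
  exact h0

theorem inVariety_and_isPure_of_hasModel {Q : Set (NCPoly n)} (hm : ∀ i, 1 ≤ m i)
    (h : HasModel f m Q T E) : InVariety f m Q T ∧ IsPure f T := by
  obtain ⟨V, hV, hQ⟩ := (hasModel_iff Q).1 h
  obtain ⟨hdom, hpure⟩ := inPolydomain_and_isPure_of_kernelForm (commute_of_intertwinesShift hV) hm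
    (kernelForm_of_intertwinesShift hm hV)
  exact ⟨⟨hdom, fun q hq => evalPoly_eq_zero_of_model hV hQ hq⟩, hpure⟩

end ModelMap

section Converse

variable {k : ℕ} {n : Fin k → ℕ} {H : Type*} [NormedAddCommGroup H] [InnerProductSpace ℂ H]
  [CompleteSpace H] {f : ∀ i, PosRegFreeHol (n i)} {m : Fin k → ℕ}
  {T : ∀ i, Fin (n i) → H →L[ℂ] H}

theorem completeSpace_defectSpace : CompleteSpace (defectSpace f m T) :=
  (Submodule.isClosed_topologicalClosure _).completeSpace_coe

/-- The operator `Δ^m(I)^{1/2}`, with values in the closure of its range. -/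
def defectSqrt (f : ∀ i, PosRegFreeHol (n i)) (m : Fin k → ℕ)
    (T : ∀ i, Fin (n i) → H →L[ℂ] H) : H →L[ℂ] defectSpace f m T :=
  (CFC.sqrt (defect f T m 1)).codRestrict (defectSpace f m T) fun x =>
    Submodule.le_topologicalClosure _ ⟨x, rfl⟩

theorem kernelForm_defectSqrt (hT : InPolydomain f m T) (hpure : IsPure f T) (x : H) :
    kernelForm f T (defectSqrt f m T) m x = ‖x‖ₑ ^ 2 := by
  rw [← tsum_quad_defect f m T hT hpure x, kernelForm]
  refine tsum_congr fun γ => ?_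
  rw [← enorm_sqrt_apply (hT.defect_nonneg m le_rfl)]
  rfl

theorem hasModel_of_isPure {Q : Set (NCPoly n)} (hm : ∀ i, 1 ≤ m i) (hT : InVariety f m Q T)
    (hpure : IsPure f T) : HasModel f m Q T (defectSpace f m T) := by
  have : CompleteSpace (defectSpace f m T) := completeSpace_defectSpace
  obtain ⟨V, hV⟩ := exists_intertwinesShift hm hT.commute
    (kernelForm_defectSqrt hT.toInPolydomain hpure)
  exact (hasModel_iff Q).2 ⟨V, hV, fun x hx y h =>
    inner_smulVec_eq_zero_of_mem_MQ hV hT.eval_eq_zero hx y h⟩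

end Converse

end NCPolydomain

end

theorem mainTheorem7 {k : ℕ} {n : Fin k → ℕ} (m : Fin k → ℕ) (hm : ∀ i, 1 ≤ m i)
    (f : ∀ i, PosRegFreeHol (n i)) (Q : Set (NCPoly n))
    {H : Type*} [NormedAddCommGroup H] [InnerProductSpace ℂ H] [CompleteSpace H]
    (T : ∀ i, Fin (n i) → H →L[ℂ] H) :
    ((InVariety f m Q T ∧ IsPure f T) ↔
      ((∀ i, WeaklyConvergent (f i) (T i)) ∧ 0 ≤ defect f T m 1 ∧
        HasModel f m Q T (defectSpace f m T))) ∧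
    ∀ (E : Type*) [NormedAddCommGroup E] [InnerProductSpace ℂ E] [CompleteSpace E],
      HasModel f m Q T E → InVariety f m Q T ∧ IsPure f T := by
  refine ⟨⟨fun ⟨hT, hpure⟩ => ⟨hT.convergent, hT.defect_nonneg m le_rfl,
    hasModel_of_isPure hm hT hpure⟩, fun ⟨_, _, hmodel⟩ => ?_⟩,
    fun E _ _ _ hmodel => inVariety_and_isPure_of_hasModel hm hmodel⟩
  have : CompleteSpace (defectSpace f m T) := completeSpace_defectSpace
  exact inVariety_and_isPure_of_hasModel hm hmodel
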